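/- Throughout, for a function or tempered distribution on $\mathbb{R}$ put $\widehat f(\xi)=\int f(x)e^{-ix\xi}\,dx$. Let $w$ be a polynomial with real coefficients of degree at least $2$, and let $t\in\mathbb{R}\setminus\{0\}$. For a tempered distribution $\phi$ on $\mathbb{R}$ let $U(t)\phi$ be the tempered distribution with $\widehat{U(t)\phi}(\xi)=e^{-itw(\xi)}\widehat\phi(\xi)$, and let $K_t=U(t)\delta$. For a tempered distribution $f$, $\tau>0$ and $x,\xi\in\mathbb{R}$ let $$P^\tau f(x,\xi)=\int_{\mathbb{R}} e^{-iy\xi}e^{-\tau(y-x)^2}f(y)\,dy$$ (in the sense of distributions) be its FBI transform, and for $x,\xi,\lambda\in\mathbb{R}$ let $$I(\lambda)=I(\lambda;x,\xi)=\int_{\mathbb{R}} e^{-i\left(t\,w(\lambda^2\xi-\lambda z)+\lambda x z\right)}e^{-z^2/4}\,dz .$$ Then: 1. $P^\tau K_t(x,\tau\xi)=\frac{1}{2\sqrt\pi}\,I(\sqrt\tau;x,\xi)$ for all $\tau>0$ and $x,\xi\in\mathbb{R}$. 2. For every $x_0\in\mathbb{R}$ there are a neighborhood $U\subseteq\mathbb{R}$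 of $x_0$ and constants $C,\sigma,M,\lambda_0>0$ such that $$|I(\lambda;x,\xi)|\le C e^{-\sigma\lambda^2}\qquad\text{for all } |\xi|>M,\ x\in U,\ \lambda>\lambda_0 .$$ 3. $K_t$ is real-analytic: there is a real-analytic function $k:\mathbb{R}\to\mathbb{C}$ with $K_t(\psi)=\int k\psi$ for every $\psi\in C_c^\infty(\mathbb{R})$. 4. $\operatorname{supp}(U(t)\phi)=\mathbb{R}$ for every nonzero distribution $\phi$ on $\mathbb{R}$ with compact support. -/

import Mathlib

open scoped SchwartzMap FourierTransform ContDiff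

namespace DispersiveFBI

/-! ### Functions `P * exp Q` with `P`, `Q` polynomials -/

theorem hasDerivAt_polyExp (P Q : Polynomial ℂ) (y : ℝ) :
    HasDerivAt (fun y : ℝ => P.eval (y : ℂ) * Complex.exp (Q.eval (y : ℂ)))
      ((P.derivative + P * Q.derivative).eval (y : ℂ) * Complex.exp (Q.eval (y : ℂ))) y := by
  have h1 : HasDerivAt (fun z : ℂ => P.eval z * Complex.exp (Q.eval z))
      (P.derivative.eval (y : ℂ) * Complex.exp (Q.eval (y : ℂ)) +
        P.eval (y : ℂ) * (Complex.exp (Q.eval (y : ℂ)) * Q.derivative.eval (y : ℂ))) (y : ℂ) :=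
    (P.hasDerivAt _).mul (Q.hasDerivAt _).cexp
  convert h1.comp_ofReal using 1
  simp only [Polynomial.eval_add, Polynomial.eval_mul]
  ring

theorem exists_iteratedDeriv_polyExp (P Q : Polynomial ℂ) (n : ℕ) :
    ∃ R : Polynomial ℂ,
      iteratedDeriv n (fun y : ℝ => P.eval (y : ℂ) * Complex.exp (Q.eval (y : ℂ))) =
        fun y : ℝ => R.eval (y : ℂ) * Complex.exp (Q.eval (y : ℂ)) := by
  induction n with
  | zero => exact ⟨P, by simp⟩
  | succ n ih =>
    obtain ⟨R, hR⟩ := ih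
    refine ⟨R.derivative + R * Q.derivative, ?_⟩
    rw [iteratedDeriv_succ, hR]
    funext y
    exact (hasDerivAt_polyExp R Q y).deriv

theorem contDiff_polyExp (Q : Polynomial ℂ) :
    ContDiff ℝ ∞ (fun y : ℝ => Complex.exp (Q.eval (y : ℂ))) := by
  have h : ContDiff ℂ ∞ (fun z : ℂ => Complex.exp (Q.eval z)) := by
    have : ContDiff ℂ ∞ (fun z : ℂ => Q.eval z) := by
      simpa using Q.contDiff_aeval (𝕜 := ℂ) (R := ℂ) (n := ∞)
    exact this.cexp
  exact (h.restrict_scalars ℝ).comp Complex.ofRealCLM.contDiff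

theorem norm_eval_le (R : Polynomial ℂ) :
    ∃ (k : ℕ) (C : ℝ), 0 ≤ C ∧ ∀ y : ℝ, ‖R.eval (y : ℂ)‖ ≤ C * (1 + ‖y‖) ^ k := by
  refine ⟨R.natDegree, ∑ i ∈ Finset.range (R.natDegree + 1), ‖R.coeff i‖,
    Finset.sum_nonneg fun _ _ => norm_nonneg _, fun y => ?_⟩
  rw [Polynomial.eval_eq_sum_range, Finset.sum_mul]
  refine (norm_sum_le _ _).trans (Finset.sum_le_sum fun i hi => ?_)
  rw [norm_mul, norm_pow, Complex.norm_real]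
  refine mul_le_mul_of_nonneg_left ?_ (norm_nonneg _)
  calc ‖y‖ ^ i ≤ (1 + ‖y‖) ^ i := by gcongr; linarith
    _ ≤ (1 + ‖y‖) ^ R.natDegree :=
        pow_le_pow_right₀ (by linarith [norm_nonneg y]) (by simpa [Nat.lt_succ_iff] using hi)

/-! ### The dispersive propagator -/

/-- The multiplier `e^{-i t w}`, written in the frequency variable of Mathlib's Fourier transform
`𝓕 f ξ = ∫ f x e^{-2π i x ξ} dx`: it is evaluated at `2πξ`, so that multiplication by it is
multiplication by `e^{-i t w(ξ)}` for the normalization `f̂ ξ = ∫ f x e^{-i x ξ} dx`. -/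
noncomputable def symbol (w : ℝ → ℝ) (t : ℝ) (ξ : ℝ) : ℂ :=
  Complex.exp (-(Complex.I * t * w (2 * Real.pi * ξ)))

/-- For polynomial `w` the multiplier has temperate growth, so it acts on tempered
distributions by multiplication. -/
theorem hasTemperateGrowth_symbol (w : Polynomial ℝ) (t : ℝ) :
    (symbol (fun ξ => w.eval ξ) t).HasTemperateGrowth := by
  set Q : Polynomial ℂ := Polynomial.C (-(Complex.I * t)) *
    (w.map Complex.ofRealHom).comp (Polynomial.C ((2 * Real.pi : ℝ) : ℂ) * Polynomial.X) with hQ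
  have hw (s : ℝ) : (w.map Complex.ofRealHom).eval (s : ℂ) = ((w.eval s : ℝ) : ℂ) := by
    rw [Polynomial.eval_map]
    exact Polynomial.eval₂_at_apply Complex.ofRealHom s
  have hev (y : ℝ) : Q.eval (y : ℂ) = -(Complex.I * t * (w.eval (2 * Real.pi * y) : ℝ)) := by
    simp only [hQ, Polynomial.eval_mul, Polynomial.eval_comp, Polynomial.eval_C,
      Polynomial.eval_X, ← Complex.ofReal_mul, hw]
    ring
  have heq : symbol (fun ξ => w.eval ξ) t = fun y : ℝ => Complex.exp (Q.eval (y : ℂ)) := by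
    funext y
    rw [hev, symbol]
  rw [heq]
  refine ⟨contDiff_polyExp Q, fun n => ?_⟩
  obtain ⟨R, hR⟩ := exists_iteratedDeriv_polyExp 1 Q n
  simp only [Polynomial.eval_one, one_mul] at hR
  obtain ⟨k, C, -, hC⟩ := norm_eval_le R
  refine ⟨k, C, fun y => ?_⟩
  rw [norm_iteratedFDeriv_eq_norm_iteratedDeriv, hR, norm_mul, Complex.norm_exp, hev]
  simpa using hC y

/-- `U(t) = exp(-itL)` on tempered distributions, `L` being the Fourier multiplier with
symbol `w`: `(U(t)φ)^ = e^{-itw} φ̂`. -/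
noncomputable def propagator (w : ℝ → ℝ) (t : ℝ) : 𝓢'(ℝ, ℂ) →L[ℂ] 𝓢'(ℝ, ℂ) :=
  TemperedDistribution.fourierMultiplierCLM ℂ (symbol w t)

/-- The fundamental solution `K_t = U(t)δ`. -/
noncomputable def fundamentalSolution (w : ℝ → ℝ) (t : ℝ) : 𝓢'(ℝ, ℂ) :=
  propagator w t (TemperedDistribution.delta 0)

/-! ### The FBI transform -/

/-- The wave packet `y ↦ e^{-iyξ} e^{-τ(y-x)²}` as a Schwartz function, for `τ > 0`. -/
noncomputable def wavePacket (τ : ℝ) (hτ : 0 < τ) (x ξ : ℝ) : 𝓢(ℝ, ℂ) where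
  toFun y := Complex.exp (-(Complex.I * y * ξ)) * Complex.exp (-(τ * (y - x) ^ 2))
  smooth' := by
    have h : ContDiff ℝ ∞ (fun y : ℝ => (y : ℂ)) := Complex.ofRealCLM.contDiff
    fun_prop
  decay' := by
    intro k n
    set Q : Polynomial ℂ := -(Polynomial.C (Complex.I * ξ) * Polynomial.X) -
      Polynomial.C (τ : ℂ) * (Polynomial.X - Polynomial.C (x : ℂ)) ^ 2 with hQ
    have heq : (fun y : ℝ => Complex.exp (-(Complex.I * y * ξ)) *
        Complex.exp (-(τ * (y - x) ^ 2))) = fun y : ℝ => Complex.exp (Q.eval (y : ℂ)) := by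
      funext y
      rw [← Complex.exp_add]
      congr 1
      simp only [hQ, Polynomial.eval_sub, Polynomial.eval_neg, Polynomial.eval_mul,
        Polynomial.eval_pow, Polynomial.eval_C, Polynomial.eval_X]
      ring
    have hre (y : ℝ) : (Q.eval (y : ℂ)).re = -(τ * (y - x) ^ 2) := by
      simp [hQ, pow_two]
    obtain ⟨R, hR⟩ := exists_iteratedDeriv_polyExp 1 Q n
    simp only [Polynomial.eval_one, one_mul] at hR
    obtain ⟨m, C, hC0, hC⟩ := norm_eval_le R
    -- a power of `1 + |y|` against the Gaussian
    have hbdd : ∃ D : ℝ, ∀ y : ℝ, (1 + ‖y‖) ^ (k + m) * Real.exp (-(τ * (y - x) ^ 2)) ≤ D := by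
      set b : ℝ := 1 + |x| with hb
      have hb1 : 1 ≤ b := by rw [hb]; linarith [abs_nonneg x]
      refine ⟨(k + m).factorial * Real.exp (b + 1 / (4 * τ)), fun y => ?_⟩
      set s : ℝ := |y - x|
      have hs0 : 0 ≤ s := abs_nonneg _
      have hy : 1 + ‖y‖ ≤ b + s := by
        have := abs_add_le (y - x) x
        rw [sub_add_cancel] at this
        rw [Real.norm_eq_abs]
        linarith
      have h1 : (1 + ‖y‖) ^ (k + m) ≤ (k + m).factorial * Real.exp (b + s) := by
        have h2 := Real.pow_div_factorial_le_exp (b + s) (by linarith) (k + m)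
        rw [div_le_iff₀ (by positivity)] at h2
        calc (1 + ‖y‖) ^ (k + m) ≤ (b + s) ^ (k + m) := by gcongr
          _ ≤ _ := by linarith
      have h3 : s - τ * (y - x) ^ 2 ≤ 1 / (4 * τ) := by
        rw [← sq_abs (y - x), le_div_iff₀ (by positivity)]
        nlinarith [sq_nonneg (2 * τ * s - 1)]
      calc (1 + ‖y‖) ^ (k + m) * Real.exp (-(τ * (y - x) ^ 2))
          ≤ (k + m).factorial * Real.exp (b + s) * Real.exp (-(τ * (y - x) ^ 2)) := by gcongr
        _ = (k + m).factorial * Real.exp (b + (s - τ * (y - x) ^ 2)) := by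
            rw [mul_assoc, ← Real.exp_add]; ring_nf
        _ ≤ _ := by gcongr
    obtain ⟨D, hD⟩ := hbdd
    refine ⟨C * D, fun y => ?_⟩
    rw [norm_iteratedFDeriv_eq_norm_iteratedDeriv, heq, hR, norm_mul, Complex.norm_exp, hre]
    calc ‖y‖ ^ k * (‖R.eval (y : ℂ)‖ * Real.exp (-(τ * (y - x) ^ 2)))
        ≤ (1 + ‖y‖) ^ k * ((C * (1 + ‖y‖) ^ m) * Real.exp (-(τ * (y - x) ^ 2))) := by
          gcongr
          · linarith
          · exact hC y
      _ = C * ((1 + ‖y‖) ^ (k + m) * Real.exp (-(τ * (y - x) ^ 2))) := by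
          rw [pow_add]; ring
      _ ≤ C * D := by gcongr; exact hD y

/-- The FBI transform `P^τ u (x, ξ) = ∫ e^{-iyξ} e^{-τ(y-x)²} u(y) dy` of a tempered distribution
`u`, for `τ > 0`: the pairing of `u` with the wave packet. -/
noncomputable def fbiTransform (u : 𝓢'(ℝ, ℂ)) (τ : ℝ) (hτ : 0 < τ) (x ξ : ℝ) : ℂ :=
  u (wavePacket τ hτ x ξ)

/-- `I(λ) = ∫ e^{-i(t w(λ²ξ - λz) + λxz)} e^{-z²/4} dz`; here `l` stands for `λ`. -/
noncomputable def fbiIntegral (w : ℝ → ℝ) (t x ξ l : ℝ) : ℂ :=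
  ∫ z : ℝ, Complex.exp (-(Complex.I * (t * w (l ^ 2 * ξ - l * z) + l * x * z))) *
    Complex.exp (-(z ^ 2 / 4))

/-! ### Real-analytic distributions -/

/-- The tempered distribution `u` is (given by integration against) a real-analytic function
on the real line. -/
def IsRealAnalytic (u : 𝓢'(ℝ, ℂ)) : Prop :=
  ∃ k : ℝ → ℂ, AnalyticOnNhd ℝ k Set.univ ∧
    ∀ ψ : 𝓢(ℝ, ℂ), HasCompactSupport ψ → u ψ = ∫ y : ℝ, k y * ψ y

end DispersiveFBI

/-!
The polynomial `w` grows fast enough that `e^{-itw}`, which only oscillates on the real line, decays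
on one side of it. Near `+∞` the sign of `Re w'` is constant in a thin sector around the half-line
and `|Re w'|` grows at least linearly (`exists_re_aeval_ge`; this is where `deg w ≥ 2` enters), so
moving from `p` by `a` into the correct half-plane multiplies `|e^{-itw}|` by at most `e^{-κpa}`
(`exists_im_aeval_le`). The end `-∞` is the end `+∞` of `w(-·)`, possibly with the other half-plane.
Everything else is contour deformation.

* The FBI integral: the part `|z| ≤ λ|ξ|/2` of the line is moved to height `±1`, where the
  frequency `λ²ξ - λz` is still at least `λ²|ξ|/2` in absolute value; the rest of the line and the
  two short sides are controlled by the Gaussian (`exists_norm_fbiIntegral_le_of_pos`).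

* The kernel: rotating each half-line into its sector turns `∫ e^{ixξ - itw(ξ)} dξ` into an
  integral with Gaussian decay, hence into an entire function `k` of `x`
  (`exists_entire_tendsto_halfLine`), and the transposed propagator acts on test functions by
  correlation with `k` (`exists_entire_isKernel`).

* Compactly supported `φ`: such a `φ` has finite order, so by the Hahn-Banach theorem it is a
  continuous functional of finitely many derivatives on a compact interval
  (`exists_eq_clm_jetLM`). As `U(t)` commutes with differentiation and the translates of the entire
  function `k` depend analytically on the translation in the supremum norm, `U(t)φ` is real-analytic
  (`isRealAnalytic_propagator`). The case `φ = δ` is the analyticity of `K_t`. If `U(t)φ`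
  vanishes on a nonempty open set, its analytic density vanishes identically; test functions being dense in the
  Schwartz space, `U(t)φ = 0`, and `U(-t)` gives `φ = 0`.
-/

namespace DispersiveFBI

open Filter Topology MeasureTheory

/-! ### Growth of a real polynomial off the real line -/

theorem aeval_ofReal (w : Polynomial ℝ) (p : ℝ) :
    Polynomial.aeval (p : ℂ) w = ((w.eval p : ℝ) : ℂ) :=
  (Polynomial.ofReal_eval w p).symm

/-- In a thin sector around the positive half-line, `Re q` has a constant sign and grows at least
linearly: after division by `p ^ q.natDegree` it is a continuous function of `1 / p` and `a / p`
whose value at the origin is the leading coefficient. -/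
theorem exists_re_aeval_ge (q : Polynomial ℝ) (hq : 1 ≤ q.natDegree) :
    ∃ s : ℝ, (s = 1 ∨ s = -1) ∧ ∃ c > (0 : ℝ), ∃ δ > (0 : ℝ), ∃ P > (0 : ℝ),
      ∀ p ≥ P, ∀ a : ℝ, |a| ≤ δ * p →
        c * p ≤ s * (Polynomial.aeval ((p : ℂ) + Complex.I * a) q).re := by
  set n := q.natDegree with hn
  have hlc : q.leadingCoeff ≠ 0 := by
    intro h
    rw [Polynomial.leadingCoeff_eq_zero] at h
    simp [h] at hn
    omega
  obtain ⟨s, hs, hsl⟩ : ∃ s : ℝ, (s = 1 ∨ s = -1) ∧ s * q.leadingCoeff = |q.leadingCoeff| := by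
    rcases le_total 0 q.leadingCoeff with h | h
    · exact ⟨1, Or.inl rfl, by rw [abs_of_nonneg h, one_mul]⟩
    · exact ⟨-1, Or.inr rfl, by rw [abs_of_nonpos h]; ring⟩
  set F : ℝ × ℝ → ℝ := fun v => s *
    (∑ k ∈ Finset.range (n + 1), q.coeff k • ((1 + Complex.I * v.2) ^ k *
      (v.1 : ℂ) ^ (n - k))).re with hF
  have hFc : Continuous F := by
    simp only [hF]
    fun_prop
  have hF0 : F (0, 0) = |q.leadingCoeff| := by
    simp only [hF]
    rw [Finset.sum_eq_single n]
    · simp [← hsl, hn]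
    · intro k hk hkn
      have : n - k ≠ 0 := by
        have := Finset.mem_range.1 hk
        omega
      simp [this]
    · simp
  have hpos : 0 < |q.leadingCoeff| := abs_pos.2 hlc
  have hev : ∀ᶠ v in 𝓝 ((0, 0) : ℝ × ℝ), |q.leadingCoeff| / 2 < F v :=
    hFc.continuousAt.eventually_const_lt (by rw [hF0]; linarith)
  obtain ⟨ε, hε, hball⟩ := Metric.eventually_nhds_iff.1 hev
  refine ⟨s, hs, |q.leadingCoeff| / 2, by positivity, ε / 2, by positivity, 1 + 2 / ε,
    by positivity, fun p hp a ha => ?_⟩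
  have hp1 : 1 ≤ p := le_trans (by linarith [show (0 : ℝ) < 2 / ε by positivity]) hp
  have hp0 : 0 < p := by linarith
  have h1 : p⁻¹ < ε := by
    have h2 : 2 / ε < p := by linarith
    rw [div_lt_iff₀ hε] at h2
    rw [inv_lt_iff_one_lt_mul₀ hp0]
    linarith
  have hFv : |q.leadingCoeff| / 2 < F (p⁻¹, a / p) := by
    apply hball
    rw [Prod.dist_eq, max_lt_iff]
    simp only [dist_zero_right, Real.norm_eq_abs, abs_div, abs_inv, abs_of_pos hp0]
    refine ⟨h1, ?_⟩
    rw [div_lt_iff₀ hp0]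
    nlinarith
  have hscale : s * (Polynomial.aeval ((p : ℂ) + Complex.I * a) q).re = p ^ n * F (p⁻¹, a / p) := by
    have hpc : (p : ℂ) ≠ 0 := by exact_mod_cast hp0.ne'
    have : Polynomial.aeval ((p : ℂ) + Complex.I * a) q = ((p ^ n : ℝ) : ℂ) *
        ∑ k ∈ Finset.range (n + 1), q.coeff k • ((1 + Complex.I * ((a / p : ℝ) : ℂ)) ^ k *
          ((p⁻¹ : ℝ) : ℂ) ^ (n - k)) := by
      rw [Polynomial.aeval_eq_sum_range, Finset.mul_sum]
      refine Finset.sum_congr rfl fun k hk => ?_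
      have hk' : k ≤ n := by simpa [Nat.lt_succ_iff] using hk
      rw [mul_smul_comm]
      congr 1
      have e1 : (p : ℂ) + Complex.I * a = p * (1 + Complex.I * ((a / p : ℝ) : ℂ)) := by
        push_cast
        field_simp
      rw [e1, mul_pow]
      have e2 : ((p ^ n : ℝ) : ℂ) = (p : ℂ) ^ k * (p : ℂ) ^ (n - k) := by
        rw [← pow_add, Nat.add_sub_cancel' hk']
        push_cast
        rfl
      rw [e2]
      push_cast
      have e3 : (p : ℂ) ^ (n - k) * ((p : ℂ)⁻¹) ^ (n - k) = 1 := by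
        rw [← mul_pow, mul_inv_cancel₀ hpc, one_pow]
      linear_combination (-(p : ℂ) ^ k * (1 + Complex.I * (a / p)) ^ k) * e3
    rw [this, Complex.re_ofReal_mul]
    simp only [hF]
    ring
  rw [hscale]
  have hpn : p ≤ p ^ n := le_self_pow₀ hp1 (by omega)
  calc |q.leadingCoeff| / 2 * p ≤ F (p⁻¹, a / p) * p ^ n :=
        mul_le_mul hFv.le hpn hp0.le (le_trans (by positivity) hFv.le)
    _ = _ := mul_comm _ _

/-- The sign on one side of the real axis: moving down (`e = 1`) or up (`e = -1`) from a large
positive `p`, the function `e^{-itw}` decays exponentially. -/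
theorem exists_im_aeval_le (w : Polynomial ℝ) (hw : 2 ≤ w.natDegree) (t : ℝ) (ht : t ≠ 0) :
    ∃ e : ℝ, (e = 1 ∨ e = -1) ∧ ∃ κ > (0 : ℝ), ∃ δ > (0 : ℝ), ∃ P > (0 : ℝ),
      ∀ p ≥ P, ∀ a : ℝ, 0 ≤ a → a ≤ δ * p →
        t * (Polynomial.aeval ((p : ℂ) - Complex.I * (e * a)) w).im ≤ -(κ * p * a) := by
  have hd : 1 ≤ w.derivative.natDegree := by
    rw [Polynomial.natDegree_derivative]
    omega
  obtain ⟨s, hs, c, hc, δ, hδ, P, hP, hmain⟩ := exists_re_aeval_ge w.derivative hd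
  have hs2 : s * s = 1 := by rcases hs with rfl | rfl <;> norm_num
  obtain ⟨e, he, het⟩ : ∃ e : ℝ, (e = 1 ∨ e = -1) ∧ t * e = |t| * s := by
    rcases le_total 0 t with h | h
    · exact ⟨s, hs, by rw [abs_of_nonneg h]⟩
    · refine ⟨-s, by rcases hs with rfl | rfl <;> simp, by rw [abs_of_nonpos h]; ring⟩
  have he1 : |e| = 1 := by rcases he with rfl | rfl <;> norm_num
  refine ⟨e, he, |t| * c, by positivity, δ, hδ, P, hP, fun p hp a ha0 ha => ?_⟩
  set h : ℝ → ℝ := fun b =>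
    t * (Polynomial.aeval ((p : ℂ) - Complex.I * (e * b)) w).im + |t| * c * p * b with hh
  have hder (b : ℝ) : HasDerivAt h
      (-(t * e) * (Polynomial.aeval ((p : ℂ) - Complex.I * (e * b)) w.derivative).re +
        |t| * c * p) b := by
    have h1 : HasDerivAt (fun b : ℝ => (p : ℂ) - Complex.I * (e * b)) (-(Complex.I * e)) b := by
      have := (((hasDerivAt_id b).ofReal_comp.const_mul (e : ℂ)).const_mul Complex.I).const_sub
        (p : ℂ)
      simpa using this
    have h2 : HasDerivAt (fun b : ℝ => Polynomial.aeval ((p : ℂ) - Complex.I * (e * b)) w)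
        (Polynomial.aeval ((p : ℂ) - Complex.I * (e * b)) w.derivative * -(Complex.I * e)) b :=
      HasDerivAt.comp b (w.hasDerivAt_aeval _) h1
    have h3 := (Complex.imCLM.hasFDerivAt.comp_hasDerivAt b h2).const_mul t
    have h4 := h3.add ((hasDerivAt_id b).const_mul (|t| * c * p))
    refine h4.congr_deriv ?_
    simp [Complex.mul_im]
    ring
  have hanti : AntitoneOn h (Set.Icc 0 a) := by
    refine antitoneOn_of_deriv_nonpos (convex_Icc 0 a)
      (fun b _ => (hder b).continuousAt.continuousWithinAt)
      (fun b _ => (hder b).differentiableAt.differentiableWithinAt) fun b hb => ?_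
    rw [interior_Icc] at hb
    rw [(hder b).deriv, het]
    have h5 := hmain p hp (-(e * b)) (by
      rw [abs_neg, abs_mul, he1, one_mul, abs_of_pos hb.1]
      linarith [hb.2])
    have h6 : (p : ℂ) - Complex.I * (e * b) = p + Complex.I * ((-(e * b) : ℝ) : ℂ) := by
      push_cast
      ring
    rw [h6]
    nlinarith [mul_le_mul_of_nonneg_left h5 (abs_nonneg t)]
  have hle := hanti (Set.left_mem_Icc.2 ha0) (Set.right_mem_Icc.2 ha0) ha0
  have h0 : h 0 = 0 := by
    simp only [hh]
    rw [show (p : ℂ) - Complex.I * (e * ((0 : ℝ) : ℂ)) = (p : ℂ) by simp]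
    simp [aeval_ofReal]
  rw [h0] at hle
  simp only [hh] at hle
  linarith

/-! ### Exponential decay of the FBI integral -/

/-- The integrand of `fbiIntegral` for polynomial `w`, continued to complex `z`. -/
noncomputable def fbiIntegrand (w : Polynomial ℝ) (t x ξ l : ℝ) (z : ℂ) : ℂ :=
  Complex.exp (-(Complex.I * (t * Polynomial.aeval ((l : ℂ) ^ 2 * ξ - l * z) w + l * x * z)) -
    z ^ 2 / 4)

theorem fbiIntegral_eq (w : Polynomial ℝ) (t x ξ l : ℝ) :
    fbiIntegral (fun η => w.eval η) t x ξ l = ∫ y : ℝ, fbiIntegrand w t x ξ l y := by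
  unfold fbiIntegral fbiIntegrand
  congr 1
  funext y
  rw [← Complex.exp_add]
  congr 1
  have h : Polynomial.aeval ((l : ℂ) ^ 2 * ξ - l * y) w =
      ((w.eval (l ^ 2 * ξ - l * y) : ℝ) : ℂ) := by
    rw [← aeval_ofReal]
    push_cast
    rfl
  rw [h]
  ring

theorem differentiable_fbiIntegrand (w : Polynomial ℝ) (t x ξ l : ℝ) :
    Differentiable ℂ (fbiIntegrand w t x ξ l) := by
  unfold fbiIntegrand
  have h : Differentiable ℂ fun z : ℂ => Polynomial.aeval ((l : ℂ) ^ 2 * ξ - l * z) w :=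
    (w.differentiable_aeval (𝕜 := ℂ)).comp (f := fun z : ℂ => (l : ℂ) ^ 2 * ξ - l * z) (by fun_prop)
  fun_prop

theorem norm_fbiIntegrand (w : Polynomial ℝ) (t x ξ l y b : ℝ) :
    ‖fbiIntegrand w t x ξ l (y + b * Complex.I)‖ =
      Real.exp (t * (Polynomial.aeval (((l ^ 2 * ξ - l * y : ℝ) : ℂ) - Complex.I * (l * b)) w).im +
        l * x * b - (y ^ 2 - b ^ 2) / 4) := by
  unfold fbiIntegrand
  rw [Complex.norm_exp]
  congr 1
  have : (l : ℂ) ^ 2 * ξ - l * (y + b * Complex.I) =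
      ((l ^ 2 * ξ - l * y : ℝ) : ℂ) - Complex.I * (l * b) := by
    push_cast
    ring
  rw [this]
  simp [pow_two]

theorem norm_fbiIntegrand_ofReal (w : Polynomial ℝ) (t x ξ l y : ℝ) :
    ‖fbiIntegrand w t x ξ l y‖ = Real.exp (-(y ^ 2 / 4)) := by
  have h := norm_fbiIntegrand w t x ξ l y 0
  simp only [Complex.ofReal_zero, zero_mul, add_zero, mul_zero, sub_zero, aeval_ofReal,
    Complex.ofReal_im] at h
  rw [h]
  ring_nf

/-- Reflecting `z` exchanges the two ends of the frequency line. -/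
theorem fbiIntegral_neg (w : Polynomial ℝ) (t x ξ l : ℝ) :
    fbiIntegral (fun η => w.eval η) t x ξ l =
      fbiIntegral (fun η => (w.comp (-Polynomial.X)).eval η) t (-x) (-ξ) l := by
  unfold fbiIntegral
  rw [← integral_neg_eq_self]
  congr 1
  funext z
  simp only [Polynomial.eval_comp, Polynomial.eval_neg, Polynomial.eval_X]
  push_cast
  ring_nf

theorem integral_gaussian_outside_le {R l : ℝ} (hR : 0 ≤ R) (hl : 8 * l ^ 2 ≤ R ^ 2) {f : ℝ → ℂ}
    (hf : ∀ y, ‖f y‖ = Real.exp (-(y ^ 2 / 4))) :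
    ‖∫ y in (Set.Ioc (-R) R)ᶜ, f y‖ ≤
      Real.exp (-l ^ 2) * ∫ y : ℝ, Real.exp (-(1 / 8) * y ^ 2) := by
  have hint : Integrable fun y : ℝ => Real.exp (-l ^ 2) * Real.exp (-(1 / 8) * y ^ 2) :=
    (integrable_exp_neg_mul_sq (by norm_num)).const_mul _
  rw [← integral_const_mul]
  calc ‖∫ y in (Set.Ioc (-R) R)ᶜ, f y‖
      ≤ ∫ y in (Set.Ioc (-R) R)ᶜ, Real.exp (-l ^ 2) * Real.exp (-(1 / 8) * y ^ 2) := by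
        refine norm_integral_le_of_norm_le hint.integrableOn ?_
        refine (ae_restrict_iff' measurableSet_Ioc.compl).2 (Eventually.of_forall fun y hy => ?_)
        rw [hf, ← Real.exp_add, Real.exp_le_exp]
        have hy2 : R ^ 2 ≤ y ^ 2 := by
          simp only [Set.mem_compl_iff, Set.mem_Ioc, not_and_or, not_lt, not_le] at hy
          rcases hy with hy | hy
          · nlinarith
          · nlinarith
        linarith
    _ ≤ _ := setIntegral_le_integral hint (Eventually.of_forall fun y => by positivity)

/-- Cauchy's theorem on the rectangle with vertices `±R` and `±R + ie`. -/
theorem norm_integral_interval_le_of_shift {f : ℂ → ℂ} (hf : Differentiable ℂ f) {R A B e : ℝ}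
    (hR : 0 ≤ R) (he : e = 1 ∨ e = -1) {g : ℝ → ℝ} (hg : Integrable g) (hg0 : 0 ≤ g)
    (htop : ∀ y ∈ Set.Icc (-R) R, ‖f (y + e * Complex.I)‖ ≤ A * g y) (hA : 0 ≤ A)
    (hside : ∀ s ∈ Set.Icc (0 : ℝ) 1, ‖f (R + (e * s : ℝ) * Complex.I)‖ ≤ B ∧
      ‖f (-R + (e * s : ℝ) * Complex.I)‖ ≤ B) :
    ‖∫ y in (-R)..R, f y‖ ≤ A * (∫ y, g y) + 2 * B := by
  have hrect := Complex.integral_boundary_rect_eq_zero_of_differentiableOn f (-R : ℂ)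
    (R + e * Complex.I) hf.differentiableOn
  simp only [Complex.neg_re, Complex.ofReal_re, Complex.neg_im, Complex.ofReal_im, neg_zero,
    Complex.ofReal_zero, zero_mul, add_zero, Complex.add_re, Complex.mul_re, Complex.I_re, mul_zero,
    Complex.I_im, mul_one, sub_zero, Complex.add_im, Complex.mul_im, zero_add, smul_eq_mul,
    Complex.ofReal_neg] at hrect
  have hs (b : ℝ) (hb : b ∈ Set.uIoc 0 e) : ∃ s ∈ Set.Icc (0 : ℝ) 1, b = e * s := by
    rcases he with rfl | rfl
    · rw [Set.uIoc_of_le (by norm_num)] at hb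
      exact ⟨b, ⟨hb.1.le, hb.2⟩, by ring⟩
    · rw [Set.uIoc_of_ge (by norm_num)] at hb
      exact ⟨-b, ⟨by linarith [hb.2], by linarith [hb.1]⟩, by ring⟩
  have he1 : |e - 0| = 1 := by rcases he with rfl | rfl <;> norm_num
  have hv1 : ‖∫ y in (0 : ℝ)..e, f (R + y * Complex.I)‖ ≤ B := by
    refine (intervalIntegral.norm_integral_le_of_norm_le_const (C := B) fun b hb => ?_).trans_eq
      (by rw [he1, mul_one])
    obtain ⟨s, hs1, rfl⟩ := hs b hb
    exact (hside s hs1).1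
  have hv2 : ‖∫ y in (0 : ℝ)..e, f (-R + y * Complex.I)‖ ≤ B := by
    refine (intervalIntegral.norm_integral_le_of_norm_le_const (C := B) fun b hb => ?_).trans_eq
      (by rw [he1, mul_one])
    obtain ⟨s, hs1, rfl⟩ := hs b hb
    exact (hside s hs1).2
  have htop' : ‖∫ y in (-R)..R, f (y + e * Complex.I)‖ ≤ A * ∫ y, g y := by
    rw [← integral_const_mul, intervalIntegral.integral_of_le (by linarith)]
    calc _ ≤ ∫ y in Set.Ioc (-R) R, A * g y := by
          refine norm_integral_le_of_norm_le (hg.const_mul A).integrableOn ?_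
          exact (ae_restrict_iff' measurableSet_Ioc).2 (Eventually.of_forall fun y hy =>
            htop y ⟨hy.1.le, hy.2⟩)
      _ ≤ _ := setIntegral_le_integral (hg.const_mul A)
          (Eventually.of_forall fun y => mul_nonneg hA (hg0 y))
  have heq : ∫ y in (-R)..R, f y = (∫ y in (-R)..R, f (y + e * Complex.I)) -
      Complex.I * (∫ y in (0 : ℝ)..e, f (R + y * Complex.I)) +
      Complex.I * ∫ y in (0 : ℝ)..e, f (-R + y * Complex.I) := by
    linear_combination hrect
  rw [heq]
  refine (norm_add_le _ _).trans ?_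
  have h1 := norm_sub_le (∫ y in (-R)..R, f (y + e * Complex.I))
    (Complex.I * (∫ y in (0 : ℝ)..e, f (R + y * Complex.I)))
  rw [norm_mul, Complex.norm_I, one_mul] at h1 ⊢
  linarith

theorem sq_add_mul_le_of_large {l B κ ξ p : ℝ} (hl : 1 < l) (hB : 0 ≤ B) (hκ : 0 < κ)
    (hξ : 2 * (1 + B) < ξ * κ) (hp : l ^ 2 * ξ / 2 ≤ p) : l ^ 2 + l * B ≤ κ * p * l := by
  have h6 : κ * (l ^ 2 * ξ / 2) ≤ κ * p := mul_le_mul_of_nonneg_left hp hκ.le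
  have h7 : l ^ 2 * (1 + B) ≤ κ * p := by nlinarith [sq_nonneg l]
  have h8 : l ^ 2 * (1 + B) * l ≤ κ * p * l := mul_le_mul_of_nonneg_right h7 (by linarith)
  have h1 : l ^ 2 ≤ l ^ 2 * l := le_mul_of_one_le_right (sq_nonneg l) hl.le
  have h9 : l * B ≤ l ^ 2 * l * B := mul_le_mul_of_nonneg_right (by nlinarith) hB
  linarith

/-- Decay for positive frequencies. The piece `|y| ≤ λξ/2` of the real line is moved to height
`±1`: there the frequency `λ²ξ - λy` stays above `λ²ξ/2`, so `exists_im_aeval_le` applies, and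
the Gaussian factor controls everything else. -/
theorem exists_norm_fbiIntegral_le_of_pos (w : Polynomial ℝ) (hw : 2 ≤ w.natDegree) (t : ℝ)
    (ht : t ≠ 0) (B : ℝ) (hB : 0 ≤ B) :
    ∃ C > (0 : ℝ), ∃ M > (0 : ℝ), ∀ ξ : ℝ, M < ξ → ∀ x : ℝ, |x| ≤ B → ∀ l : ℝ, 1 < l →
      ‖fbiIntegral (fun η => w.eval η) t x ξ l‖ ≤ C * Real.exp (-l ^ 2) := by
  obtain ⟨e, he, κ, hκ, δ, hδ, P, hP, hmain⟩ := exists_im_aeval_le w hw t ht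
  have hgauss : 0 ≤ ∫ y : ℝ, Real.exp (-(1 / 4) * y ^ 2) :=
    integral_nonneg fun y => by positivity
  have hgauss8 : 0 ≤ ∫ y : ℝ, Real.exp (-(1 / 8) * y ^ 2) :=
    integral_nonneg fun y => by positivity
  -- With `p = l²ξ - ly` and `R = lξ/2`, the four summands of the threshold for `ξ` ensure in turn
  -- `P ≤ p`, `l ≤ δp`, a gain `κpl ≥ l² + lB` that absorbs the term in `x`, and `8l² ≤ R²`.
  refine ⟨Real.exp (1 / 4) * (∫ y : ℝ, Real.exp (-(1 / 4) * y ^ 2)) + 2 * Real.exp (1 / 4) +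
    ∫ y : ℝ, Real.exp (-(1 / 8) * y ^ 2), by positivity,
    2 * P + 2 / δ + 2 * (1 + B) / κ + 6, by positivity, fun ξ hξ x hx l hl => ?_⟩
  have hl0 : 0 < l := by linarith
  have hδ2 : 0 < 2 / δ := by positivity
  have hκ2 : 0 < 2 * (1 + B) / κ := by positivity
  have hξ1 : 2 * P < ξ := by linarith
  have hξ2 : 2 < ξ * δ := by
    rw [← div_lt_iff₀ hδ]
    linarith
  have hξ3 : 2 * (1 + B) < ξ * κ := by
    rw [← div_lt_iff₀ hκ]
    linarith
  have hξ4 : 6 < ξ := by linarith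
  have hξ0 : 0 < ξ := by linarith
  set R : ℝ := l * ξ / 2 with hR
  have hR0 : 0 ≤ R := by positivity
  have he2 : e ^ 2 = 1 := by rcases he with rfl | rfl <;> norm_num
  have he1 : |e| = 1 := by rcases he with rfl | rfl <;> norm_num
  -- the basic estimate on the closed rectangle
  have hest : ∀ y ∈ Set.Icc (-R) R, ∀ s ∈ Set.Icc (0 : ℝ) 1,
      ‖fbiIntegrand w t x ξ l (y + (e * s : ℝ) * Complex.I)‖ ≤
        Real.exp (1 / 4 - l ^ 2 * s - y ^ 2 / 4) := by
    intro y hy s hs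
    rw [norm_fbiIntegrand, Real.exp_le_exp]
    have hp1 : l ^ 2 * ξ / 2 ≤ l ^ 2 * ξ - l * y := by
      have := mul_le_mul_of_nonneg_left hy.2 hl0.le
      rw [hR] at this
      nlinarith
    set p : ℝ := l ^ 2 * ξ - l * y
    have hl2 : l ≤ l ^ 2 := by nlinarith
    have hp2 : l * ξ / 2 ≤ p := by nlinarith
    have hpP : P ≤ p := by nlinarith
    have hpδ : l * s ≤ δ * p := by
      have h1 : l * s ≤ l := by nlinarith [hs.2]
      have h2 : l ≤ δ * (l * ξ / 2) := by nlinarith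
      nlinarith [mul_le_mul_of_nonneg_left hp2 hδ.le]
    have h1 := hmain p hpP (l * s) (by have := hs.1; positivity) hpδ
    have h2 : (l : ℂ) * ((e * s : ℝ) : ℂ) = e * ((l * s : ℝ) : ℂ) := by
      push_cast
      ring
    rw [h2]
    have h3 : l * x * (e * s) ≤ l * B * s := by
      have h4 : x * e ≤ B := (le_abs_self _).trans (by rw [abs_mul, he1, mul_one]; exact hx)
      have h5 : 0 ≤ l * s := mul_nonneg hl0.le hs.1
      nlinarith
    have h4 : (e * s) ^ 2 ≤ 1 := by
      rw [mul_pow, he2, one_mul]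
      nlinarith [hs.1, hs.2]
    have h5 : l ^ 2 + l * B ≤ κ * p * l := sq_add_mul_le_of_large hl hB hκ hξ3 hp1
    have h6 := mul_le_mul_of_nonneg_right h5 hs.1
    linarith
  have hRl : 8 * l ^ 2 ≤ R ^ 2 := by
    have h1 : 36 ≤ ξ ^ 2 := by nlinarith
    have h2 : R ^ 2 = l ^ 2 * ξ ^ 2 / 4 := by
      rw [hR]
      ring
    have h3 := mul_le_mul_of_nonneg_left h1 (sq_nonneg l)
    have h4 := sq_nonneg l
    linarith
  have hmid : ‖∫ y in (-R)..R, fbiIntegrand w t x ξ l y‖ ≤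
      Real.exp (1 / 4 - l ^ 2) * (∫ y : ℝ, Real.exp (-(1 / 4) * y ^ 2)) +
        2 * Real.exp (1 / 4 - l ^ 2) := by
    refine norm_integral_interval_le_of_shift (differentiable_fbiIntegrand w t x ξ l) hR0 he
      (integrable_exp_neg_mul_sq (by norm_num)) (fun y => (Real.exp_pos _).le) ?_
      (Real.exp_pos _).le ?_
    · intro y hy
      have := hest y hy 1 (by simp)
      rw [mul_one] at this
      refine this.trans_eq ?_
      rw [← Real.exp_add]
      ring_nf
    · intro s hs
      have hsl := mul_nonneg (sq_nonneg l) hs.1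
      have hl2 := sq_nonneg l
      constructor
      · refine (hest R ⟨by linarith, le_refl R⟩ s hs).trans (Real.exp_le_exp.2 ?_)
        linarith
      · have := hest (-R) ⟨le_refl _, by linarith⟩ s hs
        rw [Complex.ofReal_neg] at this
        refine this.trans (Real.exp_le_exp.2 ?_)
        linarith
  have hout := integral_gaussian_outside_le hR0 hRl (norm_fbiIntegrand_ofReal w t x ξ l)
  have hint : Integrable fun y : ℝ => fbiIntegrand w t x ξ l y := by
    have : Integrable fun y : ℝ => Real.exp (-(1 / 4) * y ^ 2) :=
      integrable_exp_neg_mul_sq (by norm_num)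
    refine this.mono' ?_ (Eventually.of_forall fun y => ?_)
    · exact ((differentiable_fbiIntegrand w t x ξ l).continuous.comp
        Complex.continuous_ofReal).aestronglyMeasurable
    · rw [norm_fbiIntegrand_ofReal]
      exact Real.exp_le_exp.2 (by linarith)
  rw [fbiIntegral_eq, ← integral_add_compl (measurableSet_Ioc (a := -R) (b := R)) hint,
    ← intervalIntegral.integral_of_le (by linarith)]
  refine (norm_add_le _ _).trans ((add_le_add hmid hout).trans_eq ?_)
  rw [sub_eq_add_neg, Real.exp_add]
  ring

theorem exists_norm_fbiIntegral_le (w : Polynomial ℝ) (hw : 2 ≤ w.natDegree) (t : ℝ)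
    (ht : t ≠ 0) (x₀ : ℝ) :
    ∃ U ∈ 𝓝 x₀, ∃ C > (0 : ℝ), ∃ σ > (0 : ℝ), ∃ M > (0 : ℝ), ∃ l₀ > (0 : ℝ),
      ∀ ξ : ℝ, M < |ξ| → ∀ x ∈ U, ∀ l : ℝ, l₀ < l →
        ‖fbiIntegral (fun η => w.eval η) t x ξ l‖ ≤ C * Real.exp (-(σ * l ^ 2)) := by
  have hw' : 2 ≤ (w.comp (-Polynomial.X)).natDegree := by
    rwa [Polynomial.natDegree_comp, Polynomial.natDegree_neg, Polynomial.natDegree_X, mul_one]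
  obtain ⟨C₁, hC₁, M₁, hM₁, h₁⟩ :=
    exists_norm_fbiIntegral_le_of_pos w hw t ht (|x₀| + 1) (by positivity)
  obtain ⟨C₂, hC₂, M₂, hM₂, h₂⟩ :=
    exists_norm_fbiIntegral_le_of_pos _ hw' t ht (|x₀| + 1) (by positivity)
  refine ⟨Metric.ball x₀ 1, Metric.ball_mem_nhds _ one_pos, C₁ + C₂, by positivity, 1, one_pos,
    max M₁ M₂, lt_max_of_lt_left hM₁, 1, one_pos, fun ξ hξ x hx l hl => ?_⟩
  have hxB : |x| ≤ |x₀| + 1 := by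
    rw [Metric.mem_ball, Real.dist_eq] at hx
    have := abs_add_le (x - x₀) x₀
    rw [sub_add_cancel] at this
    linarith
  rw [one_mul, add_mul]
  have he := Real.exp_pos (-l ^ 2)
  rcases le_total 0 ξ with h | h
  · rw [abs_of_nonneg h] at hξ
    have := h₁ ξ ((le_max_left _ _).trans_lt hξ) x hxB l hl
    nlinarith
  · rw [abs_of_nonpos h] at hξ
    have := h₂ (-ξ) ((le_max_right _ _).trans_lt hξ) (-x) (by rwa [abs_neg]) l hl
    rw [fbiIntegral_neg]
    nlinarith

/-! ### The kernel of the propagator is entire -/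

theorem differentiable_integral_cexp_mul {μ : Measure ℝ} (m : ℂ) {g : ℝ → ℂ}
    (hg : AEStronglyMeasurable g μ)
    (hint : ∀ c : ℝ, Integrable (fun p => Real.exp (c * |p|) * ‖g p‖) μ) :
    Differentiable ℂ fun z : ℂ => ∫ p, Complex.exp (Complex.I * z * (p * m)) * g p ∂μ := by
  intro z₀
  have hmeas (z : ℂ) : AEStronglyMeasurable
      (fun p : ℝ => Complex.exp (Complex.I * z * (p * m)) * g p) μ :=
    (Continuous.aestronglyMeasurable (by fun_prop)).mul hg
  have hexp (z : ℂ) (p : ℝ) :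
      ‖Complex.exp (Complex.I * z * (p * m))‖ ≤ Real.exp (‖z‖ * ‖m‖ * |p|) := by
    refine (Complex.norm_exp_le_exp_norm _).trans_eq ?_
    simp only [norm_mul, Complex.norm_I, one_mul, Complex.norm_real, Real.norm_eq_abs]
    ring_nf
  refine (hasDerivAt_integral_of_dominated_loc_of_deriv_le
    (F := fun (z : ℂ) (p : ℝ) => Complex.exp (Complex.I * z * (p * m)) * g p)
    (F' := fun z p => Complex.exp (Complex.I * z * (p * m)) * (Complex.I * (p * m)) * g p)
    (bound := fun p => Real.exp ((‖z₀‖ + 2) * ‖m‖ * |p|) * ‖g p‖)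
    (Metric.ball_mem_nhds z₀ one_pos) (Eventually.of_forall hmeas) ?_ ?_ ?_
    (hint _) ?_).2.differentiableAt
  · refine (hint (‖z₀‖ * ‖m‖)).mono' (hmeas z₀) (Eventually.of_forall fun p => ?_)
    rw [norm_mul]
    gcongr
    exact hexp z₀ p
  · exact (Continuous.aestronglyMeasurable (by fun_prop)).mul hg
  · refine Eventually.of_forall fun p z hz => ?_
    rw [norm_mul, norm_mul]
    gcongr
    have h1 : ‖z‖ ≤ ‖z₀‖ + 1 := by
      have := norm_sub_norm_le z z₀
      rw [Metric.mem_ball, dist_eq_norm] at hz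
      linarith
    have h2 : ‖Complex.I * (p * m)‖ ≤ Real.exp (‖m‖ * |p|) := by
      simp only [norm_mul, Complex.norm_I, one_mul, Complex.norm_real, Real.norm_eq_abs]
      have := Real.add_one_le_exp (‖m‖ * |p|)
      linarith
    calc _ ≤ Real.exp (‖z‖ * ‖m‖ * |p|) * Real.exp (‖m‖ * |p|) :=
          mul_le_mul (hexp z p) h2 (norm_nonneg _) (Real.exp_pos _).le
      _ = Real.exp ((‖z‖ + 1) * ‖m‖ * |p|) := by
          rw [← Real.exp_add]
          ring_nf
      _ ≤ _ := Real.exp_le_exp.2 (by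
          have : ‖z‖ + 1 ≤ ‖z₀‖ + 2 := by linarith
          gcongr)
  · refine Eventually.of_forall fun p z _ => ?_
    have h1 : HasDerivAt (fun z : ℂ => Complex.I * z * (p * m)) (Complex.I * (p * m)) z := by
      simpa using ((hasDerivAt_id z).const_mul Complex.I).mul_const ((p : ℂ) * m)
    exact h1.cexp.mul_const (g p)

/-- Cauchy's theorem on the triangle with vertices `0`, `R` and `R (1 - ieδ)`. -/
theorem integral_interval_eq_ray {f : ℂ → ℂ} (hf : Differentiable ℂ f) (R e δ : ℝ) :
    ∫ p in (0 : ℝ)..R, f p =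
      (∫ p in (0 : ℝ)..R, (1 - Complex.I * (e * δ)) * f (p * (1 - Complex.I * (e * δ)))) +
        Complex.I * e * ∫ s in (0 : ℝ)..(δ * R), f (R - Complex.I * (e * s)) := by
  obtain ⟨F, hF⟩ := hf.isExactOn_univ
  replace hF := fun z => hF z (Set.mem_univ z)
  have hc := hf.continuous
  have h1 : ∫ p in (0 : ℝ)..R, f p = F R - F (0 : ℝ) :=
    intervalIntegral.integral_eq_sub_of_hasDerivAt (f := fun p : ℝ => F p)
      (fun p _ => (hF p).comp_ofReal)
      (Continuous.intervalIntegrable (by fun_prop) _ _)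
  have h2 : ∫ p in (0 : ℝ)..R,
      (1 - Complex.I * (e * δ)) * f (p * (1 - Complex.I * (e * δ))) =
      F (R * (1 - Complex.I * (e * δ))) - F ((0 : ℝ) * (1 - Complex.I * (e * δ))) := by
    refine intervalIntegral.integral_eq_sub_of_hasDerivAt
      (f := fun p : ℝ => F (p * (1 - Complex.I * (e * δ)))) (fun p _ => ?_)
      (Continuous.intervalIntegrable (by fun_prop) _ _)
    have hd : HasDerivAt (fun p : ℝ => (p : ℂ) * (1 - Complex.I * (e * δ)))
        (1 - Complex.I * (e * δ)) p := by
      simpa using ((hasDerivAt_id p).ofReal_comp).mul_const (1 - Complex.I * ((e : ℂ) * δ))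
    exact (HasDerivAt.comp p (hF _) hd).congr_deriv (mul_comm _ _)
  have h3 : ∫ s in (0 : ℝ)..(δ * R), -(Complex.I * e) * f (R - Complex.I * (e * s)) =
      F (R - Complex.I * (e * (δ * R : ℝ))) - F (R - Complex.I * (e * (0 : ℝ))) := by
    refine intervalIntegral.integral_eq_sub_of_hasDerivAt
      (f := fun s : ℝ => F (R - Complex.I * (e * s))) (fun p _ => ?_)
      (Continuous.intervalIntegrable (by fun_prop) _ _)
    have hd : HasDerivAt (fun s : ℝ => (R : ℂ) - Complex.I * (e * s)) (-(Complex.I * e)) p := by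
      simpa using (((hasDerivAt_id p).ofReal_comp.const_mul (e : ℂ)).const_mul
        Complex.I).const_sub (R : ℂ)
    exact (HasDerivAt.comp p (hF _) hd).congr_deriv (mul_comm _ _)
  rw [intervalIntegral.integral_const_mul] at h3
  have e1 : (R : ℂ) - Complex.I * (e * (δ * R : ℝ)) = R * (1 - Complex.I * (e * δ)) := by
    push_cast
    ring
  rw [e1] at h3
  simp only [Complex.ofReal_zero, mul_zero, sub_zero, zero_mul] at h1 h2 h3
  rw [h1, h2]
  linear_combination h3

theorem norm_cexp_neg_I_mul (t : ℝ) (u : ℂ) :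
    ‖Complex.exp (-(Complex.I * t * u))‖ = Real.exp (t * u.im) := by
  rw [Complex.norm_exp]
  simp

/-- The oscillatory integral of `e^{-itw}` over a half-line converges to an entire function of `x`,
and its truncations stay locally bounded in `x`: rotate the half-line into the sector where
`e^{-itw}` has Gaussian decay. -/
theorem exists_entire_tendsto_halfLine (w : Polynomial ℝ) (hw : 2 ≤ w.natDegree) (t : ℝ)
    (ht : t ≠ 0) :
    ∃ r : ℂ → ℂ, Differentiable ℂ r ∧
      (∀ x : ℝ, Tendsto (fun R : ℝ => ∫ p in (0 : ℝ)..R, Complex.exp (Complex.I * x * p) *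
        Complex.exp (-(Complex.I * t * Polynomial.aeval (p : ℂ) w))) atTop (𝓝 (r x))) ∧
      ∀ A : ℝ, ∃ C : ℝ, ∀ x : ℝ, |x| ≤ A → ∀ R ≥ (0 : ℝ),
        ‖∫ p in (0 : ℝ)..R, Complex.exp (Complex.I * x * p) *
          Complex.exp (-(Complex.I * t * Polynomial.aeval (p : ℂ) w))‖ ≤ C := by
  obtain ⟨e, he, κ, hκ, δ, hδ, P, hP, hmain⟩ := exists_im_aeval_le w hw t ht
  have he1 : |e| = 1 := by rcases he with rfl | rfl <;> norm_num
  have hWd : Differentiable ℂ fun z : ℂ => Polynomial.aeval z w :=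
    w.differentiable_aeval (𝕜 := ℂ)
  have hWc := hWd.continuous
  set m : ℂ := 1 - Complex.I * (e * δ) with hm
  set g : ℝ → ℂ := fun p =>
    m * Complex.exp (-(Complex.I * t * Polynomial.aeval (p * m) w)) with hg
  have hgc : Continuous g := by
    have : Continuous fun p : ℝ => Polynomial.aeval ((p : ℂ) * m) w :=
      hWc.comp (f := fun p : ℝ => (p : ℂ) * m) (by fun_prop)
    fun_prop
  have hgn {p : ℝ} (hp : P ≤ p) : ‖g p‖ ≤ ‖m‖ * Real.exp (-(κ * p * (δ * p))) := by
    rw [hg, norm_mul, norm_cexp_neg_I_mul]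
    gcongr
    have hp0 : 0 < p := hP.trans_le hp
    refine le_trans (le_of_eq ?_) (hmain p hp (δ * p) (by positivity) le_rfl)
    congr 4
    rw [hm]
    push_cast
    ring
  have hint (c : ℝ) : IntegrableOn (fun p => Real.exp (c * |p|) * ‖g p‖) (Set.Ioi 0) := by
    refine integrable_of_isBigO_exp_neg (b := 1) one_pos
      (Continuous.continuousOn (by fun_prop)) (Asymptotics.IsBigO.of_bound ‖m‖ ?_)
    filter_upwards [eventually_ge_atTop P, eventually_ge_atTop ((c + 1) / (κ * δ))] with p hp hp2
    have hp0 : 0 < p := hP.trans_le hp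
    rw [norm_mul, norm_norm, Real.norm_of_nonneg (Real.exp_pos _).le,
      Real.norm_of_nonneg (Real.exp_pos _).le, abs_of_pos hp0]
    rw [div_le_iff₀ (by positivity)] at hp2
    calc Real.exp (c * p) * ‖g p‖
        ≤ Real.exp (c * p) * (‖m‖ * Real.exp (-(κ * p * (δ * p)))) := by
          gcongr
          exact hgn hp
      _ = ‖m‖ * Real.exp (c * p - κ * p * (δ * p)) := by
          rw [sub_eq_add_neg, Real.exp_add]
          ring
      _ ≤ _ := by
          gcongr
          nlinarith
  set f : ℝ → ℂ → ℂ := fun x z =>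
    Complex.exp (Complex.I * x * z) * Complex.exp (-(Complex.I * t * Polynomial.aeval z w)) with hf
  have hfd (x : ℝ) : Differentiable ℂ (f x) := by
    simp only [hf]
    fun_prop
  have hnf (x : ℝ) (p : ℝ) : ‖Complex.exp (Complex.I * x * (p * m)) * g p‖ ≤
      Real.exp (|x| * ‖m‖ * |p|) * ‖g p‖ := by
    rw [norm_mul]
    gcongr
    refine (Complex.norm_exp_le_exp_norm _).trans_eq ?_
    simp only [norm_mul, Complex.norm_I, one_mul, Complex.norm_real, Real.norm_eq_abs]
    ring_nf
  have hfint (x : ℝ) : IntegrableOn (fun p : ℝ => Complex.exp (Complex.I * x * (p * m)) * g p)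
      (Set.Ioi 0) := by
    refine (hint (|x| * ‖m‖)).mono' (Continuous.aestronglyMeasurable (by fun_prop))
      (Eventually.of_forall (hnf x))
  -- the short side of the triangle
  have hside (x A R : ℝ) (hx : |x| ≤ A) (hRP : P ≤ R) (hRA : A + 1 ≤ κ * R) :
      ‖∫ s in (0 : ℝ)..(δ * R), f x (R - Complex.I * (e * s))‖ ≤ (κ * R - A)⁻¹ := by
    have hR0 : 0 < R := hP.trans_le hRP
    have hb : 0 < κ * R - A := by linarith
    have h1 : ‖∫ s in (0 : ℝ)..(δ * R), f x (R - Complex.I * (e * s))‖ ≤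
        ∫ s in (0 : ℝ)..(δ * R), Real.exp (-(κ * R - A) * s) := by
      refine intervalIntegral.norm_integral_le_of_norm_le (by positivity)
        (Eventually.of_forall fun s hs => ?_) (Continuous.intervalIntegrable (by fun_prop) _ _)
      simp only [hf]
      rw [norm_mul, norm_cexp_neg_I_mul, Complex.norm_exp, ← Real.exp_add, Real.exp_le_exp]
      have h2 := hmain R hRP s hs.1.le hs.2
      have h3 : (Complex.I * x * (R - Complex.I * (e * s))).re = x * e * s := by
        simp
        ring
      have h4 : x * e ≤ A := (le_abs_self _).trans (by rw [abs_mul, he1, mul_one]; exact hx)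
      have h5 := mul_le_mul_of_nonneg_right h4 hs.1.le
      rw [h3]
      linarith
    have h2 : ∫ s in (0 : ℝ)..(δ * R), Real.exp (-(κ * R - A) * s) =
        (κ * R - A)⁻¹ * (1 - Real.exp (-(κ * R - A) * (δ * R))) := by
      rw [intervalIntegral.integral_comp_mul_left (fun s => Real.exp s) (neg_ne_zero.2 hb.ne'),
        integral_exp]
      rw [mul_zero, Real.exp_zero, inv_neg, smul_eq_mul]
      ring
    rw [h2] at h1
    refine h1.trans (mul_le_of_le_one_right (inv_pos.2 hb).le ?_)
    linarith [Real.exp_pos (-(κ * R - A) * (δ * R))]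
  have hray (x R : ℝ) : ∫ p in (0 : ℝ)..R, f x p =
      (∫ p in (0 : ℝ)..R, Complex.exp (Complex.I * x * (p * m)) * g p) +
        Complex.I * e * ∫ s in (0 : ℝ)..(δ * R), f x (R - Complex.I * (e * s)) := by
    rw [integral_interval_eq_ray (hfd x) R e δ]
    congr 2
    funext p
    simp only [hf, hg, ← hm]
    ring
  refine ⟨fun z => ∫ p in Set.Ioi (0 : ℝ), Complex.exp (Complex.I * z * (p * m)) * g p,
    differentiable_integral_cexp_mul m hgc.aestronglyMeasurable hint, fun x => ?_, fun A => ?_⟩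
  · have h1 := intervalIntegral_tendsto_integral_Ioi 0 (hfint x) tendsto_id
    have h2 : Tendsto (fun R : ℝ => Complex.I * e *
        ∫ s in (0 : ℝ)..(δ * R), f x (R - Complex.I * (e * s))) atTop (𝓝 0) := by
      have h3 : Tendsto (fun R : ℝ => (κ * R - |x|)⁻¹) atTop (𝓝 0) :=
        tendsto_inv_atTop_zero.comp
          (tendsto_atTop_add_const_right _ _ (tendsto_id.const_mul_atTop hκ))
      refine squeeze_zero_norm' ?_ h3
      filter_upwards [eventually_ge_atTop P, eventually_ge_atTop ((|x| + 1) / κ)] with R hR hR2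
      rw [div_le_iff₀ hκ] at hR2
      rw [norm_mul, norm_mul, Complex.norm_I, Complex.norm_real, Real.norm_eq_abs, he1, one_mul,
        one_mul]
      exact hside x |x| R le_rfl hR (by linarith)
    have h4 := h1.add h2
    rw [add_zero] at h4
    exact h4.congr fun R => (hray x R).symm
  · set R₀ : ℝ := max P ((|A| + 1) / κ) with hR₀
    have hR₀0 : 0 < R₀ := lt_max_of_lt_left hP
    refine ⟨R₀ + ((∫ p in Set.Ioi (0 : ℝ), Real.exp (A * ‖m‖ * |p|) * ‖g p‖) + 1),
      fun x hx R hR => ?_⟩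
    have hI0 : 0 ≤ ∫ p in Set.Ioi (0 : ℝ), Real.exp (A * ‖m‖ * |p|) * ‖g p‖ :=
      integral_nonneg fun p => by positivity
    rcases le_total R R₀ with h | h
    · have h1 : ‖∫ p in (0 : ℝ)..R, f x p‖ ≤ 1 * |R - 0| := by
        refine intervalIntegral.norm_integral_le_of_norm_le_const fun p _ => ?_
        simp only [hf]
        rw [norm_mul, norm_cexp_neg_I_mul, Complex.norm_exp, aeval_ofReal]
        simp
      rw [one_mul, sub_zero, abs_of_nonneg hR] at h1
      refine h1.trans ?_
      linarith
    · have hRP : P ≤ R := (le_max_left _ _).trans h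
      have hRA : A + 1 ≤ κ * R := by
        have h1 : (|A| + 1) / κ ≤ R := (le_max_right _ _).trans h
        rw [div_le_iff₀ hκ] at h1
        linarith [le_abs_self A]
      change ‖∫ p in (0 : ℝ)..R, f x p‖ ≤ _
      rw [hray]
      have h1 := hside x A R hx hRP hRA
      have h2 : (κ * R - A)⁻¹ ≤ 1 := inv_le_one_of_one_le₀ (by linarith)
      have h3 : ‖∫ p in (0 : ℝ)..R, Complex.exp (Complex.I * x * (p * m)) * g p‖ ≤
          ∫ p in Set.Ioi (0 : ℝ), Real.exp (A * ‖m‖ * |p|) * ‖g p‖ := by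
        rw [intervalIntegral.integral_of_le hR]
        calc _ ≤ ∫ p in Set.Ioc (0 : ℝ) R, Real.exp (A * ‖m‖ * |p|) * ‖g p‖ := by
              refine norm_integral_le_of_norm_le ((hint _).mono_set Set.Ioc_subset_Ioi_self)
                (Eventually.of_forall fun p => (hnf x p).trans ?_)
              gcongr
          _ ≤ _ := setIntegral_mono_set (hint _)
              (Eventually.of_forall fun p => by positivity)
              (Set.Ioc_subset_Ioi_self).eventuallyLE
      refine (norm_add_le _ _).trans ?_
      rw [norm_mul, norm_mul, Complex.norm_I, Complex.norm_real, Real.norm_eq_abs, he1, one_mul,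
        one_mul]
      linarith

theorem continuous_symbol (w : Polynomial ℝ) (t : ℝ) :
    Continuous (symbol (fun η => w.eval η) t) :=
  (hasTemperateGrowth_symbol w t).1.continuous

theorem norm_symbol (w : ℝ → ℝ) (t η : ℝ) : ‖symbol w t η‖ = 1 := by
  rw [symbol, norm_cexp_neg_I_mul]
  simp

theorem norm_cexp_I_mul_ofReal (x η : ℝ) :
    ‖Complex.exp (Complex.I * (2 * Real.pi * x : ℝ) * η)‖ = 1 := by
  rw [Complex.norm_exp]
  simp

/-- The truncated inverse Fourier integrals of the symbol converge, locally boundedly, to an entire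
function: the convolution kernel of the propagator. -/
theorem exists_entire_kernel (w : Polynomial ℝ) (hw : 2 ≤ w.natDegree) (t : ℝ) (ht : t ≠ 0) :
    ∃ k : ℂ → ℂ, Differentiable ℂ k ∧
      (∀ x : ℝ, Tendsto (fun R : ℝ => ∫ η in (-R)..R,
        Complex.exp (Complex.I * (2 * Real.pi * x : ℝ) * η) * symbol (fun η => w.eval η) t η)
        atTop (𝓝 (k x))) ∧
      ∀ A : ℝ, ∃ C : ℝ, ∀ x : ℝ, |x| ≤ A → ∀ R ≥ (0 : ℝ), ‖∫ η in (-R)..R,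
        Complex.exp (Complex.I * (2 * Real.pi * x : ℝ) * η) * symbol (fun η => w.eval η) t η‖ ≤
          C := by
  have hdeg (c : ℝ) (hc : c ≠ 0) :
      2 ≤ (w.comp (Polynomial.C c * Polynomial.X)).natDegree := by
    rwa [Polynomial.natDegree_comp, Polynomial.natDegree_C_mul_X c hc, mul_one]
  have hpi : 2 * Real.pi ≠ 0 := by positivity
  obtain ⟨r₁, hr₁, hlim₁, hb₁⟩ := exists_entire_tendsto_halfLine _ (hdeg (2 * Real.pi) hpi) t ht
  obtain ⟨r₂, hr₂, hlim₂, hb₂⟩ :=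
    exists_entire_tendsto_halfLine _ (hdeg (-(2 * Real.pi)) (neg_ne_zero.2 hpi)) t ht
  have hev₁ (p : ℝ) : Complex.exp (-(Complex.I * t *
      Polynomial.aeval (p : ℂ) (w.comp (Polynomial.C (2 * Real.pi) * Polynomial.X)))) =
      symbol (fun η => w.eval η) t p := by
    simp [aeval_ofReal, symbol]
  have hev₂ (p : ℝ) : Complex.exp (-(Complex.I * t *
      Polynomial.aeval (p : ℂ) (w.comp (Polynomial.C (-(2 * Real.pi)) * Polynomial.X)))) =
      symbol (fun η => w.eval η) t (-p) := by
    simp [aeval_ofReal, symbol]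
  simp only [hev₁] at hlim₁ hb₁
  simp only [hev₂] at hlim₂ hb₂
  have hcont := continuous_symbol w t
  have hsplit (x R : ℝ) : ∫ η in (-R)..R,
      Complex.exp (Complex.I * (2 * Real.pi * x : ℝ) * η) * symbol (fun η => w.eval η) t η =
      (∫ p in (0 : ℝ)..R, Complex.exp (Complex.I * (2 * Real.pi * x : ℝ) * p) *
        symbol (fun η => w.eval η) t p) +
      ∫ p in (0 : ℝ)..R, Complex.exp (Complex.I * (2 * Real.pi * -x : ℝ) * p) *
        symbol (fun η => w.eval η) t (-p) := by
    have hi (a b : ℝ) : IntervalIntegrable (fun η : ℝ =>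
        Complex.exp (Complex.I * (2 * Real.pi * x : ℝ) * η) *
          symbol (fun η => w.eval η) t η) volume a b :=
      Continuous.intervalIntegrable (by fun_prop) _ _
    rw [← intervalIntegral.integral_add_adjacent_intervals (hi (-R) 0) (hi 0 R), add_comm]
    congr 1
    have := intervalIntegral.integral_comp_neg (a := 0) (b := R) (fun η : ℝ =>
        Complex.exp (Complex.I * (2 * Real.pi * x : ℝ) * η) *
          symbol (fun η => w.eval η) t η)
    rw [neg_zero] at this
    rw [← this]
    congr 1
    funext p
    push_cast
    ring_nf
  refine ⟨fun z => r₁ (2 * Real.pi * z) + r₂ (2 * Real.pi * -z), ?_, fun x => ?_, fun A => ?_⟩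
  · exact (hr₁.comp (by fun_prop)).add (hr₂.comp (by fun_prop))
  · have := (hlim₁ (2 * Real.pi * x)).add (hlim₂ (2 * Real.pi * -x))
    push_cast at this
    refine this.congr fun R => ?_
    rw [hsplit]
    push_cast
    rfl
  · obtain ⟨C₁, hC₁⟩ := hb₁ (2 * Real.pi * A)
    obtain ⟨C₂, hC₂⟩ := hb₂ (2 * Real.pi * A)
    have hxA (x : ℝ) (hx : |x| ≤ A) : |2 * Real.pi * x| ≤ 2 * Real.pi * A := by
      rw [abs_mul, abs_of_pos Real.two_pi_pos]
      gcongr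
    refine ⟨C₁ + C₂, fun x hx R hR => ?_⟩
    rw [hsplit]
    exact (norm_add_le _ _).trans (add_le_add (hC₁ _ (hxA x hx) R hR)
      (hC₂ _ (hxA (-x) (by rwa [abs_neg])) R hR))

/-! ### The transposed propagator on Schwartz functions -/

/-- The transpose of `propagator w t`: the Fourier multiplier with the symbol `ξ ↦ e^{-itw(-ξ)}`,
written with the two Fourier transforms exchanged. -/
noncomputable def propagatorTranspose (w : ℝ → ℝ) (t : ℝ) : 𝓢(ℝ, ℂ) →L[ℂ] 𝓢(ℝ, ℂ) :=
  FourierTransform.fourierCLM ℂ 𝓢(ℝ, ℂ) ∘L SchwartzMap.smulLeftCLM ℂ (symbol w t) ∘L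
    FourierTransform.fourierInvCLM ℂ 𝓢(ℝ, ℂ)

theorem propagator_apply (w : ℝ → ℝ) (t : ℝ) (φ : 𝓢'(ℝ, ℂ)) (ψ : 𝓢(ℝ, ℂ)) :
    propagator w t φ ψ = φ (propagatorTranspose w t ψ) := rfl

theorem fourierInv_apply_eq_integral (ψ : 𝓢(ℝ, ℂ)) (η : ℝ) :
    𝓕⁻ ψ η = ∫ x : ℝ, Complex.exp (Complex.I * (2 * Real.pi * x : ℝ) * η) * ψ x := by
  rw [SchwartzMap.fourierInv_coe, Real.fourierInv_eq']
  congr 1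
  funext x
  rw [smul_eq_mul]
  congr 2
  simp
  ring

theorem propagatorTranspose_apply (w : Polynomial ℝ) (t : ℝ) (ψ : 𝓢(ℝ, ℂ)) (y : ℝ) :
    propagatorTranspose (fun η => w.eval η) t ψ y =
      ∫ η : ℝ, Complex.exp (-(Complex.I * (2 * Real.pi * y : ℝ) * η)) *
        symbol (fun η => w.eval η) t η * 𝓕⁻ ψ η := by
  change 𝓕 (SchwartzMap.smulLeftCLM ℂ (symbol (fun η => w.eval η) t) (𝓕⁻ ψ)) y = _
  rw [SchwartzMap.fourier_coe, Real.fourier_real_eq_integral_exp_smul]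
  congr 1
  funext η
  rw [SchwartzMap.smulLeftCLM_apply_apply (hasTemperateGrowth_symbol w t), smul_eq_mul,
    smul_eq_mul, ← mul_assoc (Complex.exp _)]
  congr 3
  push_cast
  ring

theorem integral_truncated_eq (w : Polynomial ℝ) (t : ℝ) (ψ : 𝓢(ℝ, ℂ)) (y R : ℝ) (hR : 0 ≤ R) :
    ∫ η in (-R)..R, Complex.exp (-(Complex.I * (2 * Real.pi * y : ℝ) * η)) *
        symbol (fun η => w.eval η) t η * 𝓕⁻ ψ η =
      ∫ x : ℝ, (∫ η in (-R)..R, Complex.exp (Complex.I * (2 * Real.pi * (x - y) : ℝ) * η) *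
        symbol (fun η => w.eval η) t η) * ψ x := by
  have hcont := continuous_symbol w t
  have hint : Integrable (Function.uncurry fun η x : ℝ =>
      Complex.exp (Complex.I * (2 * Real.pi * (x - y) : ℝ) * η) *
        symbol (fun η => w.eval η) t η * ψ x)
      ((volume.restrict (Set.Ioc (-R) R)).prod volume) := by
    have h1 : Integrable (fun _ : ℝ => (1 : ℝ)) (volume.restrict (Set.Ioc (-R) R)) :=
      integrable_const 1
    have hψ := ψ.continuous
    refine (h1.mul_prod ψ.integrable.norm).mono' (Continuous.aestronglyMeasurable ?_)
      (Eventually.of_forall fun v => ?_)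
    · simp only [Function.uncurry_def]
      fun_prop
    · simp only [Function.uncurry_def]
      rw [norm_mul, norm_mul, norm_symbol, norm_cexp_I_mul_ofReal, mul_one]
  simp only [intervalIntegral.integral_of_le (show -R ≤ R by linarith)]
  simp only [← integral_mul_const]
  rw [← integral_integral_swap hint]
  congr 1
  funext η
  rw [fourierInv_apply_eq_integral, ← integral_const_mul]
  congr 1
  funext x
  have : Complex.exp (Complex.I * (2 * Real.pi * (x - y) : ℝ) * η) =
      Complex.exp (-(Complex.I * (2 * Real.pi * y : ℝ) * η)) *
        Complex.exp (Complex.I * (2 * Real.pi * x : ℝ) * η) := by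
    rw [← Complex.exp_add]
    congr 1
    push_cast
    ring
  rw [this]
  ring

/-- The function `k` represents `U(t)`: the transposed propagator acts on test functions by
correlation with `k`. -/
def IsKernel (w : ℝ → ℝ) (t : ℝ) (k : ℂ → ℂ) : Prop :=
  ∀ ψ : 𝓢(ℝ, ℂ), HasCompactSupport ψ → ∀ y : ℝ,
    propagatorTranspose w t ψ y = ∫ x : ℝ, k (x - y : ℝ) * ψ x

theorem exists_entire_isKernel (w : Polynomial ℝ) (hw : 2 ≤ w.natDegree) (t : ℝ) (ht : t ≠ 0) :
    ∃ k : ℂ → ℂ, Differentiable ℂ k ∧ IsKernel (fun η => w.eval η) t k := by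
  obtain ⟨k, hk, hlim, hbd⟩ := exists_entire_kernel w hw t ht
  refine ⟨k, hk, fun ψ hψ y => ?_⟩
  have hcont := continuous_symbol w t
  rw [propagatorTranspose_apply]
  have hint : Integrable fun η : ℝ => Complex.exp (-(Complex.I * (2 * Real.pi * y : ℝ) * η)) *
        symbol (fun η => w.eval η) t η * 𝓕⁻ ψ η := by
    have hF := (𝓕⁻ ψ).continuous
    refine (𝓕⁻ ψ).integrable.norm.mono' (Continuous.aestronglyMeasurable (by fun_prop))
      (Eventually.of_forall fun η => ?_)
    rw [norm_mul, norm_mul, norm_symbol, Complex.exp_neg, norm_inv, norm_cexp_I_mul_ofReal]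
    simp
  have h1 := intervalIntegral_tendsto_integral hint tendsto_neg_atTop_atBot tendsto_id
  obtain ⟨B, hB⟩ := hψ.isCompact.isBounded.subset_closedBall (0 : ℝ)
  obtain ⟨C, hC⟩ := hbd (B + |y|)
  have h2 : Tendsto (fun R : ℝ => ∫ x : ℝ, (∫ η in (-R)..R,
      Complex.exp (Complex.I * (2 * Real.pi * (x - y) : ℝ) * η) *
        symbol (fun η => w.eval η) t η) * ψ x) atTop (𝓝 (∫ x : ℝ, k (x - y : ℝ) * ψ x)) := by
    refine tendsto_integral_filter_of_dominated_convergence (fun x => C * ‖ψ x‖)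
      (Eventually.of_forall fun R => ?_) ?_ (ψ.integrable.norm.const_mul C)
      (Eventually.of_forall fun x => (hlim (x - y)).mul_const _)
    · refine Continuous.aestronglyMeasurable (Continuous.mul ?_ ψ.continuous)
      exact intervalIntegral.continuous_parametric_intervalIntegral_of_continuous' (by
        simp only [Function.uncurry_def]
        fun_prop) _ _
    · filter_upwards [eventually_ge_atTop (0 : ℝ)] with R hR
      refine Eventually.of_forall fun x => ?_
      rw [norm_mul]
      by_cases hx : ψ x = 0
      · simp [hx]
      · have hxB : |x| ≤ B := by
          have := hB (subset_tsupport _ (Function.mem_support.2 hx))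
          simpa using this
        gcongr
        exact hC (x - y) ((abs_sub _ _).trans (by linarith)) R hR
  refine tendsto_nhds_unique h1 (h2.congr' ?_)
  filter_upwards [eventually_ge_atTop (0 : ℝ)] with R hR
  exact (integral_truncated_eq w t ψ y R hR).symm

/-! ### The FBI transform of the fundamental solution -/

theorem fourierInv_wavePacket (τ : ℝ) (hτ : 0 < τ) (x ξ η : ℝ) :
    𝓕⁻ (wavePacket τ hτ x ξ) η =
      Real.sqrt (Real.pi / τ) * Complex.exp (-(Complex.I * x * (ξ - 2 * Real.pi * η)) -
        (ξ - 2 * Real.pi * η) ^ 2 / (4 * τ)) := by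
  have hτc : (τ : ℂ) ≠ 0 := by exact_mod_cast hτ.ne'
  rw [fourierInv_apply_eq_integral]
  have h := integral_cexp_quadratic (b := (-τ : ℂ)) (by simpa using hτ)
    (2 * τ * x - Complex.I * (ξ - 2 * Real.pi * η)) (-τ * x ^ 2)
  have hsq : ((Real.pi : ℂ) / -(-(τ : ℂ))) ^ (1 / 2 : ℂ) = (Real.sqrt (Real.pi / τ) : ℂ) := by
    rw [neg_neg, Real.sqrt_eq_rpow, Complex.ofReal_cpow (by positivity)]
    push_cast
    rfl
  rw [hsq] at h
  refine Eq.trans ?_ (h.trans ?_)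
  · congr 1
    funext y
    change _ * (Complex.exp (-(Complex.I * y * ξ)) * Complex.exp (-(τ * (y - x) ^ 2))) = _
    rw [← Complex.exp_add, ← Complex.exp_add]
    congr 1
    push_cast
    ring
  · congr 2
    field_simp
    ring_nf
    simp only [Complex.I_sq]
    ring

theorem fbiTransform_fundamentalSolution (w : Polynomial ℝ) (t τ : ℝ) (hτ : 0 < τ) (x ξ : ℝ) :
    fbiTransform (fundamentalSolution (fun η => w.eval η) t) τ hτ x (τ * ξ) =
      (1 / (2 * Real.sqrt Real.pi) : ℝ) *
        fbiIntegral (fun η => w.eval η) t x ξ (Real.sqrt τ) := by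
  have h1 : fbiTransform (fundamentalSolution (fun η => w.eval η) t) τ hτ x (τ * ξ) =
      ∫ η : ℝ, symbol (fun η => w.eval η) t η * 𝓕⁻ (wavePacket τ hτ x (τ * ξ)) η := by
    change propagatorTranspose (fun η => w.eval η) t (wavePacket τ hτ x (τ * ξ)) 0 = _
    rw [propagatorTranspose_apply]
    simp
  rw [h1]
  set l := Real.sqrt τ with hl
  have hl0 : 0 < l := Real.sqrt_pos.2 hτ
  have hl2 : l ^ 2 = τ := Real.sq_sqrt hτ.le
  set G : ℝ → ℂ := fun η => symbol (fun η => w.eval η) t η * 𝓕⁻ (wavePacket τ hτ x (τ * ξ)) η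
    with hG
  have hpi := Real.pi_pos
  -- the substitution `2πη = λ²ξ - λz`
  have h2 : ∫ z : ℝ, G (l ^ 2 * ξ / (2 * Real.pi) - l / (2 * Real.pi) * z) =
      (2 * Real.pi / l : ℝ) • ∫ η, G η := by
    rw [Measure.integral_comp_mul_left (fun u => G (l ^ 2 * ξ / (2 * Real.pi) - u)),
      integral_sub_left_eq_self G volume, inv_div, abs_of_pos (by positivity)]
  have h3 : ∫ η, G η = (l / (2 * Real.pi) : ℝ) •
      ∫ z : ℝ, G (l ^ 2 * ξ / (2 * Real.pi) - l / (2 * Real.pi) * z) := by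
    rw [h2, smul_smul, show l / (2 * Real.pi) * (2 * Real.pi / l) = 1 by field_simp, one_smul]
  have h4 (z : ℝ) : G (l ^ 2 * ξ / (2 * Real.pi) - l / (2 * Real.pi) * z) =
      Real.sqrt (Real.pi / τ) *
      (Complex.exp (-(Complex.I * (t * w.eval (l ^ 2 * ξ - l * z) + l * x * z))) *
        Complex.exp (-(z ^ 2 / 4))) := by
    simp only [hG, symbol, fourierInv_wavePacket]
    have e1 : 2 * Real.pi * (l ^ 2 * ξ / (2 * Real.pi) - l / (2 * Real.pi) * z) =
        l ^ 2 * ξ - l * z := by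
      field_simp
    have e2 : (2 * Real.pi : ℂ) * ((l ^ 2 * ξ / (2 * Real.pi) - l / (2 * Real.pi) * z : ℝ) : ℂ) =
        l ^ 2 * ξ - l * z := by
      exact_mod_cast e1
    rw [e1, e2, mul_left_comm, ← Complex.exp_add, ← Complex.exp_add]
    congr 2
    rw [← hl2]
    have hlc : (l : ℂ) ≠ 0 := by exact_mod_cast hl0.ne'
    push_cast
    field_simp
    ring
  rw [h3]
  simp only [h4]
  rw [integral_const_mul]
  unfold fbiIntegral
  rw [Complex.real_smul, ← mul_assoc]
  congr 1
  rw [← Complex.ofReal_mul]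
  congr 1
  rw [Real.sqrt_div hpi.le, ← hl]
  have hs : Real.sqrt Real.pi ≠ 0 := (Real.sqrt_pos.2 hpi).ne'
  have hs2 : Real.sqrt Real.pi ^ 2 = Real.pi := Real.sq_sqrt hpi.le
  field_simp
  linarith

/-! ### Test functions are dense in the Schwartz space -/

theorem exists_norm_iteratedDeriv_sub_one_le {χ : ℝ → ℂ} (hχ : ContDiff ℝ ∞ χ)
    (hsupp : HasCompactSupport χ) (i : ℕ) :
    ∃ C : ℝ, 0 ≤ C ∧ ∀ s : ℝ, |s| ≤ 1 → ∀ x : ℝ,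
      ‖iteratedFDeriv ℝ i (fun y => χ (s * y) - 1) x‖ ≤ C := by
  have hχi : ContDiff ℝ i χ := hχ.of_le (by exact_mod_cast le_top)
  obtain ⟨C, hC⟩ := (hsupp.iteratedFDeriv (𝕜 := ℝ) i).exists_bound_of_continuous
    (hχ.continuous_iteratedFDeriv (by exact_mod_cast le_top))
  have hC0 : 0 ≤ C := (norm_nonneg _).trans (hC 0)
  refine ⟨C + 1, by positivity, fun s hs x => ?_⟩
  have h1 : ‖iteratedFDeriv ℝ i (fun y => χ (s * y)) x‖ ≤ C := by
    rw [norm_iteratedFDeriv_eq_norm_iteratedDeriv]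
    have := congrFun (iteratedDeriv_comp_const_smul hχi s) x
    rw [this, norm_smul, norm_pow, Real.norm_eq_abs,
      ← norm_iteratedFDeriv_eq_norm_iteratedDeriv]
    calc |s| ^ i * ‖iteratedFDeriv ℝ i χ (s * x)‖ ≤ 1 * C :=
          mul_le_mul (pow_le_one₀ (abs_nonneg s) hs) (hC _) (norm_nonneg _) zero_le_one
      _ = C := one_mul C
  have h2 : ‖iteratedFDeriv ℝ i (fun _ : ℝ => (1 : ℂ)) x‖ ≤ 1 := by
    rcases Nat.eq_zero_or_pos i with rfl | hi
    · simp
    · rw [iteratedFDeriv_const_of_ne hi.ne']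
      simp
  have hχs : ContDiff ℝ i fun y : ℝ => χ (s * y) := hχi.comp (by fun_prop)
  rw [show (fun y => χ (s * y) - 1) = (fun y => χ (s * y)) - fun _ => (1 : ℂ) from rfl,
    iteratedFDeriv_sub_apply hχs.contDiffAt contDiffAt_const]
  exact (norm_sub_le _ _).trans (add_le_add h1 h2)

/-- Dilated cutoffs converge to the identity on the Schwartz space. -/
theorem tendsto_smulLeftCLM_cutoff {χ : ℝ → ℂ} (hχ : ContDiff ℝ ∞ χ)
    (hsupp : HasCompactSupport χ) (hone : ∀ x, |x| < 1 → χ x = 1) (f : 𝓢(ℝ, ℂ)) :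
    Tendsto (fun n : ℕ => SchwartzMap.smulLeftCLM ℂ (fun x => χ ((n + 1 : ℝ)⁻¹ * x)) f)
      atTop (𝓝 f) := by
  have hcs (n : ℕ) : HasCompactSupport fun x => χ ((n + 1 : ℝ)⁻¹ * x) :=
    hsupp.comp_homeomorph (Homeomorph.mulLeft₀ ((n + 1 : ℝ)⁻¹) (by positivity))
  have htg (n : ℕ) : (fun x => χ ((n + 1 : ℝ)⁻¹ * x)).HasTemperateGrowth :=
    (hcs n).hasTemperateGrowth (hχ.comp (by fun_prop))
  rw [(schwartz_withSeminorms ℝ ℝ ℂ).tendsto_nhds]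
  rintro ⟨k, l⟩ ε hε
  choose D hD0 hD using fun i => exists_norm_iteratedDeriv_sub_one_le hχ hsupp i
  set S : ℝ := ∑ i ∈ Finset.range (l + 1),
    l.choose i * D i * SchwartzMap.seminorm ℝ (k + 1) (l - i) f with hS
  have hS0 : 0 ≤ S := Finset.sum_nonneg fun i _ =>
    mul_nonneg (mul_nonneg (Nat.cast_nonneg _) (hD0 i)) (apply_nonneg _ _)
  have hbound (n : ℕ) : SchwartzMap.seminorm ℝ k l
      (SchwartzMap.smulLeftCLM ℂ (fun x => χ ((n + 1 : ℝ)⁻¹ * x)) f - f) ≤ (n + 1 : ℝ)⁻¹ * S := by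
    set s : ℝ := (n + 1 : ℝ)⁻¹ with hs
    have hs0 : 0 < s := by positivity
    have hs1 : |s| ≤ 1 := by
      rw [abs_of_pos hs0]
      exact inv_le_one_of_one_le₀ (by linarith [(Nat.cast_nonneg n : (0 : ℝ) ≤ n)])
    refine SchwartzMap.seminorm_le_bound ℝ k l _ (by positivity) fun x => ?_
    have hfun : ⇑(SchwartzMap.smulLeftCLM ℂ (fun x => χ (s * x)) f - f) =
        fun y => (χ (s * y) - 1) * f y := by
      funext y
      rw [sub_apply, SchwartzMap.smulLeftCLM_apply_apply (htg n), smul_eq_mul]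
      ring
    rw [hfun]
    by_cases hx : s * |x| < 1
    · have hz : (fun y => (χ (s * y) - 1) * f y) =ᶠ[𝓝 x] fun _ => 0 := by
        have : ∀ᶠ y in 𝓝 x, s * |y| < 1 :=
          (Continuous.continuousAt (by fun_prop)).eventually_lt_const hx
        filter_upwards [this] with y hy
        rw [hone _ (by rwa [abs_mul, abs_of_pos hs0]), sub_self, zero_mul]
      rw [(hz.iteratedFDeriv ℝ l).eq_of_nhds]
      simp only [iteratedFDeriv_fun_zero, Pi.zero_apply, norm_zero, mul_zero]
      positivity
    · rw [not_lt] at hx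
      have hg : ContDiff ℝ ∞ fun y : ℝ => χ (s * y) - 1 :=
        (hχ.comp (by fun_prop)).sub contDiff_const
      have hmul := norm_iteratedFDeriv_mul_le hg (f.smooth ⊤) x (n := l)
        (by exact_mod_cast le_top)
      calc ‖x‖ ^ k * ‖iteratedFDeriv ℝ l (fun y => (χ (s * y) - 1) * f y) x‖
          ≤ (s * ‖x‖) * (‖x‖ ^ k * ∑ i ∈ Finset.range (l + 1), (l.choose i : ℝ) *
            ‖iteratedFDeriv ℝ i (fun y => χ (s * y) - 1) x‖ * ‖iteratedFDeriv ℝ (l - i) f x‖) := by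
            refine (mul_le_mul_of_nonneg_left hmul (by positivity)).trans ?_
            exact le_mul_of_one_le_left (by positivity) hx
        _ = s * ∑ i ∈ Finset.range (l + 1), (l.choose i : ℝ) *
            ‖iteratedFDeriv ℝ i (fun y => χ (s * y) - 1) x‖ *
              (‖x‖ ^ (k + 1) * ‖iteratedFDeriv ℝ (l - i) f x‖) := by
            rw [Finset.mul_sum, Finset.mul_sum, Finset.mul_sum]
            refine Finset.sum_congr rfl fun i _ => ?_
            ring
        _ ≤ s * S := by
            refine mul_le_mul_of_nonneg_left (Finset.sum_le_sum fun i _ => ?_) hs0.le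
            refine mul_le_mul (mul_le_mul_of_nonneg_left (hD i s hs1 x) (Nat.cast_nonneg _))
              (SchwartzMap.le_seminorm ℝ (k + 1) (l - i) f x) (by positivity)
              (mul_nonneg (Nat.cast_nonneg _) (hD0 i))
  have hlim : Tendsto (fun n : ℕ => (n + 1 : ℝ)⁻¹ * S) atTop (𝓝 0) := by
    have := (tendsto_one_div_add_atTop_nhds_zero_nat (𝕜 := ℝ)).mul_const S
    simpa using this
  filter_upwards [hlim.eventually_lt_const hε] with n hn
  exact (hbound n).trans_lt hn

theorem exists_cutoff (R : ℝ) : ∃ χ : ℝ → ℂ, ContDiff ℝ ∞ χ ∧ HasCompactSupport χ ∧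
    ∀ x, |x| < R → χ x = 1 := by
  let b : ContDiffBump (0 : ℝ) := ⟨|R| + 1, |R| + 2, by positivity, by linarith⟩
  refine ⟨fun x => (b x : ℂ), Complex.ofRealCLM.contDiff.comp b.contDiff,
    b.hasCompactSupport.comp_left (g := fun r : ℝ => (r : ℂ)) rfl, fun x hx => ?_⟩
  have : b x = 1 := b.one_of_mem_closedBall (by
    simp only [Metric.mem_closedBall, dist_zero_right, Real.norm_eq_abs, b]
    linarith [le_abs_self R])
  simp [this]

/-- A tempered distribution that kills every compactly supported function supported in `tsupport f`
kills `f`. -/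
theorem apply_eq_zero_of_forall_hasCompactSupport (φ : 𝓢'(ℝ, ℂ)) (f : 𝓢(ℝ, ℂ))
    (h : ∀ g : 𝓢(ℝ, ℂ), HasCompactSupport g → tsupport g ⊆ tsupport f → φ g = 0) : φ f = 0 := by
  obtain ⟨χ, hχ, hsupp, hone⟩ := exists_cutoff 1
  have hcs (n : ℕ) : HasCompactSupport fun x => χ ((n + 1 : ℝ)⁻¹ * x) :=
    hsupp.comp_homeomorph (Homeomorph.mulLeft₀ ((n + 1 : ℝ)⁻¹) (by positivity))
  have htg (n : ℕ) : (fun x => χ ((n + 1 : ℝ)⁻¹ * x)).HasTemperateGrowth :=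
    (hcs n).hasTemperateGrowth (hχ.comp (by fun_prop))
  have hlim := (φ.continuous.tendsto f).comp (tendsto_smulLeftCLM_cutoff hχ hsupp hone f)
  refine tendsto_nhds_unique hlim (tendsto_const_nhds.congr fun n => ?_)
  refine (h _ ?_ ?_).symm
  · rw [SchwartzMap.smulLeftCLM_apply (htg n)]
    exact (hcs n).mul_right
  · rw [SchwartzMap.smulLeftCLM_apply (htg n)]
    exact tsupport_smul_subset_right _ _

/-! ### Distributions with compact support -/

theorem exists_smooth_cutoff_of_isCompact {s V : Set ℝ} (hs : IsCompact s) (hV : IsOpen V)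
    (hsV : s ⊆ V) : ∃ ρ : ℝ → ℂ, ContDiff ℝ ∞ ρ ∧ tsupport ρ ⊆ V ∧ ∀ᶠ x in 𝓝ˢ s, ρ x = 1 := by
  obtain ⟨ρ, h0, h1, -⟩ := exists_contMDiffMap_zero_one_nhds_of_isClosed (n := ⊤)
    (modelWithCornersSelf ℝ ℝ) hV.isClosed_compl hs.isClosed
    (Set.disjoint_compl_left_iff_subset.2 hsV)
  refine ⟨fun x => (ρ x : ℂ), Complex.ofRealCLM.contDiff.comp ρ.contMDiff.contDiff, ?_, ?_⟩
  · intro x hx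
    by_contra hxV
    rw [eventually_nhdsSet_iff_forall] at h0
    refine notMem_tsupport_iff_eventuallyEq.2 ?_ hx
    filter_upwards [h0 x hxV] with y hy
    simp [hy]
  · filter_upwards [h1] with x hx
    simp [hx]

/-- A tempered distribution vanishes on the complement of its support, by a partition of unity. -/
theorem apply_eq_zero_of_tsupport_subset_compl_dsupport (φ : 𝓢'(ℝ, ℂ)) (f : 𝓢(ℝ, ℂ))
    (hf : tsupport f ⊆ (Distribution.dsupport φ)ᶜ) : φ f = 0 := by
  refine apply_eq_zero_of_forall_hasCompactSupport φ f fun g hg hgf => ?_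
  suffices h : ∃ V : Set ℝ, IsOpen V ∧ tsupport g ⊆ V ∧
      ∀ u : 𝓢(ℝ, ℂ), HasCompactSupport u → tsupport u ⊆ V → φ u = 0 by
    obtain ⟨V, -, hgV, hV⟩ := h
    exact hV g hg hgV
  refine hg.isCompact.induction_on (p := fun s => ∃ V : Set ℝ, IsOpen V ∧ s ⊆ V ∧
      ∀ u : 𝓢(ℝ, ℂ), HasCompactSupport u → tsupport u ⊆ V → φ u = 0) ?_ ?_ ?_ ?_
  · refine ⟨∅, isOpen_empty, subset_rfl, fun u _ hu => ?_⟩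
    have : u = 0 := by
      ext x
      exact image_eq_zero_of_notMem_tsupport fun hx => hu hx
    rw [this, map_zero]
  · rintro s t hst ⟨V, hV, htV, h⟩
    exact ⟨V, hV, hst.trans htV, h⟩
  · rintro s₁ s₂ ⟨V₁, hV₁, hs₁, h₁⟩ ⟨V₂, hV₂, hs₂, h₂⟩
    refine ⟨V₁ ∪ V₂, hV₁.union hV₂, Set.union_subset_union hs₁ hs₂, fun u hu huV => ?_⟩
    obtain ⟨ρ, hρ, hρV, hρ1⟩ := exists_smooth_cutoff_of_isCompact (hu.isCompact.diff hV₂) hV₁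
      (by rintro x ⟨hx, hx2⟩; exact (huV hx).resolve_right hx2)
    have hc₁ : HasCompactSupport fun x => ρ x * u x := hu.mul_left
    have hc₂ : HasCompactSupport fun x => (1 - ρ x) * u x := hu.mul_left
    set u₁ := hc₁.toSchwartzMap (hρ.mul (u.smooth ⊤)) with hu₁
    set u₂ := hc₂.toSchwartzMap ((contDiff_const.sub hρ).mul (u.smooth ⊤)) with hu₂
    have hadd : u = u₁ + u₂ := by
      ext x
      change u x = ρ x * u x + (1 - ρ x) * u x
      ring
    rw [hadd, map_add, h₁ u₁ hc₁ ((tsupport_mul_subset_left).trans hρV), h₂ u₂ hc₂ ?_, add_zero]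
    intro x hx
    have hxu : x ∈ tsupport u := tsupport_mul_subset_right hx
    by_contra hx2
    rw [eventually_nhdsSet_iff_forall] at hρ1
    refine notMem_tsupport_iff_eventuallyEq.2 ?_ (tsupport_mul_subset_left hx)
    filter_upwards [hρ1 x ⟨hxu, hx2⟩] with y hy
    simp [hy]
  · intro x hx
    have hx' := hf (hgf hx)
    rw [Set.mem_compl_iff, Distribution.notMem_dsupport_iff] at hx'
    obtain ⟨s, hs, hso, hxs⟩ := hx'
    exact ⟨s, mem_nhdsWithin_of_mem_nhds (hso.mem_nhds hxs), s, hso, subset_rfl,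
      fun u _ hu => hs u hu⟩

theorem exists_cutoff_of_isCompact_dsupport (φ : 𝓢'(ℝ, ℂ))
    (hφ : IsCompact (Distribution.dsupport φ)) :
    ∃ χ : ℝ → ℂ, ContDiff ℝ ∞ χ ∧ HasCompactSupport χ ∧
      ∀ f : 𝓢(ℝ, ℂ), φ f = φ (SchwartzMap.smulLeftCLM ℂ χ f) := by
  obtain ⟨B, hB⟩ := hφ.isBounded.subset_closedBall (0 : ℝ)
  obtain ⟨χ, hχ, hsupp, hone⟩ := exists_cutoff (B + 1)
  refine ⟨χ, hχ, hsupp, fun f => ?_⟩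
  rw [← sub_eq_zero, ← map_sub]
  refine apply_eq_zero_of_tsupport_subset_compl_dsupport φ _ fun x hx hxs => ?_
  have hxB : |x| < B + 1 := by
    have := hB hxs
    rw [mem_closedBall_zero_iff, Real.norm_eq_abs] at this
    linarith
  refine notMem_tsupport_iff_eventuallyEq.2 ?_ hx
  have : ∀ᶠ y in 𝓝 x, |y| < B + 1 := continuous_abs.continuousAt.eventually_lt_const hxB
  filter_upwards [this] with y hy
  rw [sub_apply, SchwartzMap.smulLeftCLM_apply_apply (hsupp.hasTemperateGrowth hχ), hone y hy]
  simp

/-- A linear functional bounded by `‖J v‖` factors through `J`, by the Hahn-Banach theorem. -/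
theorem exists_clm_comp_eq_of_norm_le {V E : Type*} [AddCommGroup V] [Module ℂ V]
    [NormedAddCommGroup E] [NormedSpace ℂ E] (J : V →ₗ[ℂ] E) (φ : V →ₗ[ℂ] ℂ) (C : ℝ)
    (h : ∀ v, ‖φ v‖ ≤ C * ‖J v‖) : ∃ L : E →L[ℂ] ℂ, ∀ v, φ v = L (J v) := by
  obtain ⟨s, hs⟩ := J.rangeRestrict.exists_rightInverse_of_surjective J.range_rangeRestrict
  have hs' (y : J.range) : J (s y) = y := by
    have := LinearMap.congr_fun hs y
    exact congrArg Subtype.val this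
  let g : J.range →L[ℂ] ℂ := (φ ∘ₗ s).mkContinuous C fun y => by
    refine (h (s y)).trans_eq ?_
    rw [hs']
    rfl
  obtain ⟨L, hL, -⟩ := exists_extension_norm_eq J.range g
  refine ⟨L, fun v => ?_⟩
  have h1 : L (J v) = φ (s (J.rangeRestrict v)) := hL (J.rangeRestrict v)
  have h2 : J (v - s (J.rangeRestrict v)) = 0 := by
    rw [map_sub, hs']
    exact sub_self _
  have h3 := h (v - s (J.rangeRestrict v))
  rw [h2, norm_zero, mul_zero, norm_le_zero_iff, map_sub, sub_eq_zero] at h3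
  rw [h3, h1]

/-- Restriction of Schwartz functions to a set, as continuous functions. -/
noncomputable def restrictLM (K : Set ℝ) : 𝓢(ℝ, ℂ) →ₗ[ℂ] C(K, ℂ) where
  toFun f := ⟨fun y => f y, f.continuous.comp continuous_subtype_val⟩
  map_add' _ _ := rfl
  map_smul' _ _ := rfl

/-- The jet of order `m` of a Schwartz function on `K`. -/
noncomputable def jetLM (K : Set ℝ) (m : ℕ) : 𝓢(ℝ, ℂ) →ₗ[ℂ] (Fin (m + 1) → C(K, ℂ)) :=
  LinearMap.pi fun j => restrictLM K ∘ₗ ((SchwartzMap.derivCLM ℂ ℂ ^ (j : ℕ) :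
    𝓢(ℝ, ℂ) →L[ℂ] 𝓢(ℝ, ℂ)) : 𝓢(ℝ, ℂ) →ₗ[ℂ] 𝓢(ℝ, ℂ))

theorem jetLM_apply (K : Set ℝ) (m : ℕ) (f : 𝓢(ℝ, ℂ)) (j : Fin (m + 1)) :
    jetLM K m f j = restrictLM K ((SchwartzMap.derivCLM ℂ ℂ ^ (j : ℕ)) f) := rfl

theorem derivCLM_pow_apply (f : 𝓢(ℝ, ℂ)) (j : ℕ) :
    ⇑((SchwartzMap.derivCLM ℂ ℂ ^ j) f) = iteratedDeriv j f := by
  induction j with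
  | zero => simp
  | succ j ih =>
    rw [pow_succ', iteratedDeriv_succ, ← ih]
    rfl

theorem norm_iteratedFDeriv_le_norm_jetLM {K : Set ℝ} [CompactSpace K] {m j : ℕ} (hj : j ≤ m)
    (f : 𝓢(ℝ, ℂ)) {x : ℝ} (hx : x ∈ K) : ‖iteratedFDeriv ℝ j f x‖ ≤ ‖jetLM K m f‖ := by
  rw [norm_iteratedFDeriv_eq_norm_iteratedDeriv, ← derivCLM_pow_apply]
  have h1 := (jetLM K m f ⟨j, Nat.lt_succ_of_le hj⟩).norm_coe_le_norm ⟨x, hx⟩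
  exact h1.trans (norm_le_pi_norm (jetLM K m f) _)

/-- A compactly supported distribution has finite order: it factors through the jet of some
order on a compact set. -/
theorem exists_eq_clm_jetLM (φ : 𝓢'(ℝ, ℂ)) (hφ : IsCompact (Distribution.dsupport φ)) :
    ∃ (B : ℝ) (m : ℕ) (L : (Fin (m + 1) → C(Set.Icc (-B) B, ℂ)) →L[ℂ] ℂ),
      ∀ f, φ f = L (jetLM (Set.Icc (-B) B) m f) := by
  obtain ⟨χ, hχ, hsupp, hφχ⟩ := exists_cutoff_of_isCompact_dsupport φ hφ
  obtain ⟨B, hB⟩ := hsupp.isCompact.isBounded.subset_closedBall (0 : ℝ)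
  have hK {x : ℝ} (hx : x ∈ tsupport χ) : x ∈ Set.Icc (-B) B := by
    have := hB hx
    rw [mem_closedBall_zero_iff, Real.norm_eq_abs] at this
    exact abs_le.1 this
  have htg := hsupp.hasTemperateGrowth hχ
  have hcontq : Continuous ((normSeminorm ℂ ℂ).comp (φ : 𝓢(ℝ, ℂ) →ₗ[ℂ] ℂ)) :=
    φ.continuous.norm
  obtain ⟨S, C, -, hC⟩ := Seminorm.bound_of_continuous (schwartz_withSeminorms ℂ ℝ ℂ) _ hcontq
  set m : ℕ := S.sup Prod.snd with hm
  choose D hD using fun i => (hsupp.iteratedFDeriv (𝕜 := ℝ) i).exists_bound_of_continuous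
    (hχ.continuous_iteratedFDeriv (m := i) (by exact_mod_cast le_top))
  have hD0 (i : ℕ) : 0 ≤ D i := (norm_nonneg _).trans (hD i 0)
  -- each Schwartz seminorm of `χ f` is controlled by the jet of `f`
  have hsemi (v : ℕ × ℕ) (hv : v ∈ S) : ∃ A : ℝ, 0 ≤ A ∧ ∀ f : 𝓢(ℝ, ℂ),
      schwartzSeminormFamily ℂ ℝ ℂ v (SchwartzMap.smulLeftCLM ℂ χ f) ≤
        A * ‖jetLM (Set.Icc (-B) B) m f‖ := by
    obtain ⟨k, l⟩ := v
    have hlm : l ≤ m := Finset.le_sup (f := Prod.snd) hv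
    refine ⟨|B| ^ k * ∑ i ∈ Finset.range (l + 1), l.choose i * D i,
      mul_nonneg (by positivity) (Finset.sum_nonneg fun i _ =>
        mul_nonneg (Nat.cast_nonneg _) (hD0 i)), fun f => ?_⟩
    have hA : 0 ≤ |B| ^ k * ∑ i ∈ Finset.range (l + 1), l.choose i * D i :=
      mul_nonneg (by positivity) (Finset.sum_nonneg fun i _ =>
        mul_nonneg (Nat.cast_nonneg _) (hD0 i))
    refine SchwartzMap.seminorm_le_bound ℂ k l _ (by positivity) fun x => ?_
    rw [SchwartzMap.smulLeftCLM_apply htg]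
    by_cases hx : x ∈ tsupport χ
    · have hxK := hK hx
      have hxB : ‖x‖ ≤ |B| := (abs_le.2 hxK).trans (le_abs_self B)
      have hmul := norm_iteratedFDeriv_mul_le hχ (f.smooth ⊤) x (n := l)
        (by exact_mod_cast le_top)
      calc ‖x‖ ^ k * ‖iteratedFDeriv ℝ l (χ • ⇑f) x‖
          ≤ |B| ^ k * ∑ i ∈ Finset.range (l + 1), (l.choose i : ℝ) *
            ‖iteratedFDeriv ℝ i χ x‖ * ‖iteratedFDeriv ℝ (l - i) f x‖ := by
            gcongr
            exact hmul
        _ ≤ |B| ^ k * ∑ i ∈ Finset.range (l + 1), (l.choose i : ℝ) * D i *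
              ‖jetLM (Set.Icc (-B) B) m f‖ := by
            refine mul_le_mul_of_nonneg_left (Finset.sum_le_sum fun i _ => ?_) (by positivity)
            refine mul_le_mul (mul_le_mul_of_nonneg_left (hD i x) (Nat.cast_nonneg _))
              (norm_iteratedFDeriv_le_norm_jetLM ((Nat.sub_le _ _).trans hlm) f hxK)
              (norm_nonneg _) (mul_nonneg (Nat.cast_nonneg _) (hD0 i))
        _ = _ := by rw [← Finset.sum_mul, mul_assoc]
    · have : iteratedFDeriv ℝ l (fun y => χ y • f y) x = 0 := by
        by_contra hne
        have h1 := support_iteratedFDeriv_subset (𝕜 := ℝ) (f := fun y => χ y • f y) l hne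
        exact hx (tsupport_smul_subset_left χ f h1)
      rw [this, norm_zero, mul_zero]
      positivity
  choose! A hA0 hA using hsemi
  have hbound (f : 𝓢(ℝ, ℂ)) :
      ‖φ f‖ ≤ (C * ∑ v ∈ S, A v) * ‖jetLM (Set.Icc (-B) B) m f‖ := by
    rw [hφχ f]
    have h1 : ‖φ (SchwartzMap.smulLeftCLM ℂ χ f)‖ ≤
        C * (S.sup (schwartzSeminormFamily ℂ ℝ ℂ)) (SchwartzMap.smulLeftCLM ℂ χ f) :=
      hC (SchwartzMap.smulLeftCLM ℂ χ f)
    refine h1.trans ?_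
    rw [mul_assoc]
    refine mul_le_mul_of_nonneg_left ?_ C.2
    have hsum0 : 0 ≤ ∑ v ∈ S, A v := Finset.sum_nonneg hA0
    refine Seminorm.finset_sup_apply_le (by positivity) fun v hv => (hA v hv f).trans ?_
    gcongr
    exact Finset.single_le_sum hA0 hv
  obtain ⟨L, hL⟩ := exists_clm_comp_eq_of_norm_le (jetLM (Set.Icc (-B) B) m)
    (φ : 𝓢(ℝ, ℂ) →ₗ[ℂ] ℂ) _ hbound
  exact ⟨B, m, L, hL⟩

/-! ### Analyticity of `U(t)φ` for compactly supported `φ` -/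

/-- The translates `y ↦ k (z - y)` of a continuous function, restricted to a set of real `y`. -/
noncomputable def translates (k : C(ℂ, ℂ)) (K : Set ℝ) : C(ℂ, C(K, ℂ)) :=
  ContinuousMap.curry ⟨fun v => k (v.1 - ((v.2 : ℝ) : ℂ)), by fun_prop⟩

theorem translates_apply (k : C(ℂ, ℂ)) (K : Set ℝ) (z : ℂ) (y : K) :
    translates k K z y = k (z - ((y : ℝ) : ℂ)) := rfl

/-- For entire `k` the translates depend holomorphically on `z` in the supremum norm, since
Cauchy's formula, valid for each `y`, is an identity of continuous functions. -/
theorem analyticOnNhd_translates {k : C(ℂ, ℂ)} (hk : Differentiable ℂ k) (K : Set ℝ)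
    [CompactSpace K] : AnalyticOnNhd ℂ (translates k K) Set.univ := by
  intro c _
  have hcont := (translates k K).continuous
  have hci : CircleIntegrable (translates k K) c (1 : NNReal) :=
    hcont.continuousOn.circleIntegrable (by simp)
  have hps := hasFPowerSeriesOn_cauchy_integral hci one_pos
  refine AnalyticAt.congr ⟨_, _, hps⟩ ?_
  filter_upwards [Metric.ball_mem_nhds c one_pos] with z hz
  ext y
  have hformula := DiffContOnCl.two_pi_i_inv_smul_circleIntegral_sub_inv_smul
    (f := fun u : ℂ => k (u - ((y : ℝ) : ℂ))) (c := c) (R := 1)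
    (Differentiable.diffContOnCl (hk.comp (by fun_prop))) hz
  rw [translates_apply, ← hformula, ContinuousMap.smul_apply]
  congr 1
  have hne : ∀ u ∈ Metric.sphere c (1 : ℝ), u - z ≠ 0 := by
    intro u hu h0
    rw [sub_eq_zero] at h0
    rw [h0, Metric.mem_sphere] at hu
    rw [Metric.mem_ball, hu] at hz
    exact lt_irrefl _ hz
  have hci2 : CircleIntegrable (fun u => (u - z)⁻¹ • translates k K u) c 1 := by
    refine ContinuousOn.circleIntegrable zero_le_one ?_
    exact ((continuousOn_id.sub continuousOn_const).inv₀ hne).smul hcont.continuousOn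
  unfold circleIntegral
  have := (ContinuousMap.evalCLM ℂ (M := ℂ) y).intervalIntegral_comp_comm hci2.out
  simpa [translates_apply] using this.symm

/-- Integration by parts against an analytic function. -/
theorem exists_analytic_integral_derivCLM_pow {H : ℝ → ℂ} (hH : AnalyticOnNhd ℝ H Set.univ)
    (j : ℕ) : ∃ H' : ℝ → ℂ, AnalyticOnNhd ℝ H' Set.univ ∧ ∀ ψ : 𝓢(ℝ, ℂ), HasCompactSupport ψ →
      ∫ x, H x * (SchwartzMap.derivCLM ℂ ℂ ^ j) ψ x = ∫ x, H' x * ψ x := by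
  induction j with
  | zero => exact ⟨H, hH, fun ψ _ => by simp⟩
  | succ j ih =>
    obtain ⟨H', hH', h⟩ := ih
    refine ⟨fun x => -deriv H' x, hH'.deriv.neg, fun ψ hψ => ?_⟩
    have hψ' : HasCompactSupport (SchwartzMap.derivCLM ℂ ℂ ψ) :=
      hψ.mono' ((subset_tsupport _).trans (SchwartzMap.tsupport_derivCLM_subset ℂ ψ))
    have hc : Continuous H' := continuous_iff_continuousAt.2 fun x => (hH' x trivial).continuousAt
    have hc' : Continuous (deriv H') :=
      continuous_iff_continuousAt.2 fun x => (hH'.deriv x trivial).continuousAt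
    rw [pow_succ]
    change ∫ x, H x * (SchwartzMap.derivCLM ℂ ℂ ^ j) (SchwartzMap.derivCLM ℂ ℂ ψ) x = _
    rw [h _ hψ']
    have hd := (SchwartzMap.derivCLM ℂ ℂ ψ).continuous
    have hparts := integral_mul_deriv_eq_deriv_mul_of_integrable (u := H') (v := ψ)
      (u' := deriv H') (v' := SchwartzMap.derivCLM ℂ ℂ ψ)
      (fun x _ => (hH' x trivial).differentiableAt.hasDerivAt) (fun x _ => ψ.hasDerivAt x)
      ((hc.mul hd).integrable_of_hasCompactSupport hψ'.mul_left)
      ((hc'.mul ψ.continuous).integrable_of_hasCompactSupport hψ.mul_left)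
      ((hc.mul ψ.continuous).integrable_of_hasCompactSupport hψ.mul_left)
    rw [hparts, ← integral_neg]
    simp only [neg_mul]

open LineDeriv in
theorem propagatorTranspose_derivCLM (w : Polynomial ℝ) (t : ℝ) (ψ : 𝓢(ℝ, ℂ)) :
    propagatorTranspose (fun η => w.eval η) t (SchwartzMap.derivCLM ℂ ℂ ψ) =
      SchwartzMap.derivCLM ℂ ℂ (propagatorTranspose (fun η => w.eval η) t ψ) := by
  have hline (f : 𝓢(ℝ, ℂ)) : SchwartzMap.derivCLM ℂ ℂ f = ∂_{(1 : ℝ)} f := by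
    ext x
    rw [SchwartzMap.lineDerivOp_apply_eq_fderiv, SchwartzMap.derivCLM_apply,
      fderiv_apply_one_eq_deriv]
  have hσ := hasTemperateGrowth_symbol w t
  have hin : (fun x : ℝ => inner ℝ x (1 : ℝ)).HasTemperateGrowth := by fun_prop
  rw [hline, hline]
  change 𝓕 (SchwartzMap.smulLeftCLM ℂ _ (𝓕⁻ (∂_{(1 : ℝ)} ψ))) =
    ∂_{(1 : ℝ)} (𝓕 (SchwartzMap.smulLeftCLM ℂ _ (𝓕⁻ ψ)))
  rw [SchwartzMap.lineDerivOp_fourier_eq, SchwartzMap.fourierInv_lineDerivOp_eq]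
  congr 1
  ext x
  simp only [map_smul, smul_apply, SchwartzMap.smulLeftCLM_apply_apply hσ,
    SchwartzMap.smulLeftCLM_apply_apply hin, smul_eq_mul, Complex.real_smul]
  ring

theorem propagatorTranspose_derivCLM_pow (w : Polynomial ℝ) (t : ℝ) (ψ : 𝓢(ℝ, ℂ)) (j : ℕ) :
    propagatorTranspose (fun η => w.eval η) t ((SchwartzMap.derivCLM ℂ ℂ ^ j) ψ) =
      (SchwartzMap.derivCLM ℂ ℂ ^ j) (propagatorTranspose (fun η => w.eval η) t ψ) := by
  induction j with
  | zero => simp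
  | succ j ih =>
    rw [pow_succ']
    change propagatorTranspose _ t (SchwartzMap.derivCLM ℂ ℂ ((SchwartzMap.derivCLM ℂ ℂ ^ j) ψ)) = _
    rw [propagatorTranspose_derivCLM, ih]
    rfl

theorem hasCompactSupport_derivCLM_pow {ψ : 𝓢(ℝ, ℂ)} (hψ : HasCompactSupport ψ) (j : ℕ) :
    HasCompactSupport ((SchwartzMap.derivCLM ℂ ℂ ^ j) ψ) := by
  induction j with
  | zero => simpa using hψ
  | succ j ih =>
    rw [pow_succ']
    exact ih.mono' ((subset_tsupport _).trans (SchwartzMap.tsupport_derivCLM_subset ℂ _))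

theorem restrictLM_propagatorTranspose {w : ℝ → ℝ} {t : ℝ} {k : C(ℂ, ℂ)}
    (hk : IsKernel w t k) (K : Set ℝ) [CompactSpace K] {ψ : 𝓢(ℝ, ℂ)} (hψ : HasCompactSupport ψ) :
    Integrable (fun x : ℝ => ψ x • translates k K x) ∧
    restrictLM K (propagatorTranspose w t ψ) = ∫ x : ℝ, ψ x • translates k K x := by
  have hint : Integrable (fun x : ℝ => ψ x • translates k K x) :=
    (ψ.continuous.smul ((translates k K).continuous.comp
      Complex.continuous_ofReal)).integrable_of_hasCompactSupport hψ.smul_right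
  refine ⟨hint, ?_⟩
  ext y
  have h1 := (ContinuousMap.evalCLM ℂ (M := ℂ) y).integral_comp_comm hint
  refine (hk ψ hψ y).trans (Eq.trans ?_ h1)
  congr 1
  funext x
  simp [translates_apply, mul_comm]

/-- `U(t)φ` is real-analytic for every compactly supported `φ`: write `φ` as a sum of continuous
functionals of the derivatives, and let them act on the entire kernel. -/
theorem isRealAnalytic_propagator (w : Polynomial ℝ) (hw : 2 ≤ w.natDegree) (t : ℝ) (ht : t ≠ 0)
    (φ : 𝓢'(ℝ, ℂ)) (hφ : IsCompact (Distribution.dsupport φ)) :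
    IsRealAnalytic (propagator (fun η => w.eval η) t φ) := by
  obtain ⟨k₀, hk₀, hker⟩ := exists_entire_isKernel w hw t ht
  obtain ⟨B, m, L, hL⟩ := exists_eq_clm_jetLM φ hφ
  set k : C(ℂ, ℂ) := ⟨k₀, hk₀.continuous⟩ with hk
  set Lj : Fin (m + 1) → (C(Set.Icc (-B) B, ℂ) →L[ℂ] ℂ) := fun j =>
    L ∘SL ContinuousLinearMap.single ℂ (fun _ => C(Set.Icc (-B) B, ℂ)) j with hLj
  set H : Fin (m + 1) → ℝ → ℂ := fun j x => Lj j (translates k (Set.Icc (-B) B) x) with hH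
  have hHan (j : Fin (m + 1)) : AnalyticOnNhd ℝ (H j) Set.univ := by
    intro x _
    have h1 : AnalyticAt ℂ (fun z => Lj j (translates k (Set.Icc (-B) B) z)) (x : ℂ) :=
      (Lj j).analyticAt _ |>.comp (analyticOnNhd_translates (k := k) hk₀ (Set.Icc (-B) B) x trivial)
    exact (h1.restrictScalars (𝕜 := ℝ)).comp (g := fun z => Lj j (translates k (Set.Icc (-B) B) z))
      (Complex.ofRealCLM.analyticAt x)
  choose H' hH'an hH' using fun j : Fin (m + 1) =>
    exists_analytic_integral_derivCLM_pow (hHan j) (j : ℕ)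
  refine ⟨fun x => ∑ j, H' j x, Finset.univ.analyticOnNhd_fun_sum fun j _ => hH'an j,
    fun ψ hψ => ?_⟩
  rw [propagator_apply, hL, ← ContinuousLinearMap.sum_comp_single]
  have hterm (j : Fin (m + 1)) :
      Lj j (jetLM (Set.Icc (-B) B) m (propagatorTranspose (fun η => w.eval η) t ψ) j) =
        ∫ x, H' j x * ψ x := by
    have hψj := hasCompactSupport_derivCLM_pow hψ (j : ℕ)
    obtain ⟨hint, heq⟩ := restrictLM_propagatorTranspose (k := k) hker (Set.Icc (-B) B) hψj
    rw [jetLM_apply, ← propagatorTranspose_derivCLM_pow, heq,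
      ← (Lj j).integral_comp_comm hint, ← hH' j ψ hψ]
    congr 1
    funext x
    rw [map_smul, smul_eq_mul, mul_comm]
  refine (Finset.sum_congr rfl fun j _ => hterm j).trans ?_
  rw [← integral_finsetSum]
  · simp only [Finset.sum_mul]
  · intro j _
    have hc : Continuous (H' j) :=
      continuous_iff_continuousAt.2 fun x => (hH'an j x trivial).continuousAt
    exact (hc.mul ψ.continuous).integrable_of_hasCompactSupport hψ.mul_left

/-! ### Unique continuation -/

theorem propagator_injective (w : Polynomial ℝ) (t : ℝ) (φ : 𝓢'(ℝ, ℂ))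
    (h : propagator (fun η => w.eval η) t φ = 0) : φ = 0 := by
  have h1 : propagator (fun η => w.eval η) (-t) (propagator (fun η => w.eval η) t φ) = φ := by
    unfold propagator
    rw [TemperedDistribution.fourierMultiplierCLM_fourierMultiplierCLM_apply
      (hasTemperateGrowth_symbol w t) (hasTemperateGrowth_symbol w (-t))]
    have : symbol (fun η => w.eval η) t * symbol (fun η => w.eval η) (-t) = fun _ => (1 : ℂ) := by
      funext η
      simp only [Pi.mul_apply, symbol, ← Complex.exp_add]
      rw [show -(Complex.I * t * (w.eval (2 * Real.pi * η) : ℝ)) +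
        -(Complex.I * (-t : ℝ) * (w.eval (2 * Real.pi * η) : ℝ)) = (0 : ℂ) by push_cast; ring,
        Complex.exp_zero]
    rw [this]
    simp
  rw [← h1, h, map_zero]

/-- A real-analytic distribution whose support is not everything is zero. -/
theorem IsRealAnalytic.eq_zero_of_dsupport_ne_univ {u : 𝓢'(ℝ, ℂ)} (hu : IsRealAnalytic u)
    (h : Distribution.dsupport u ≠ Set.univ) : u = 0 := by
  obtain ⟨k, hk, hku⟩ := hu
  obtain ⟨x₀, hx₀⟩ := (Set.ne_univ_iff_exists_notMem _).1 h
  rw [Distribution.notMem_dsupport_iff] at hx₀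
  obtain ⟨s, hs, hso, hxs⟩ := hx₀
  have hkc : Continuous k := continuous_iff_continuousAt.2 fun x => (hk x trivial).continuousAt
  have hae : ∀ᵐ x, x ∈ s → k x = 0 := by
    refine hso.ae_eq_zero_of_integral_contDiff_smul_eq_zero
      (hkc.locallyIntegrable.locallyIntegrableOn s) fun g hg hgc hgs => ?_
    have hgc' : HasCompactSupport fun x => (g x : ℂ) :=
      hgc.comp_left (g := fun r : ℝ => (r : ℂ)) rfl
    have hgs' : tsupport (fun x => (g x : ℂ)) ⊆ s :=
      (tsupport_comp_subset (g := fun r : ℝ => (r : ℂ)) rfl g).trans hgs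
    set ψ : 𝓢(ℝ, ℂ) := hgc'.toSchwartzMap (Complex.ofRealCLM.contDiff.comp hg) with hψ
    have h1 : u ψ = 0 := hs ψ hgs'
    rw [hku ψ hgc'] at h1
    rw [← h1]
    congr 1
    funext x
    rw [Complex.real_smul, mul_comm]
    rfl
  have hzero : k =ᶠ[𝓝 x₀] 0 := by
    have hEq : Set.EqOn k 0 s := by
      refine Measure.eqOn_open_of_ae_eq (μ := volume) ?_ hso hkc.continuousOn continuousOn_const
      exact (ae_restrict_iff' hso.measurableSet).2 hae
    filter_upwards [hso.mem_nhds hxs] with x hx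
    exact hEq hx
  have hk0 : k = 0 := hk.eq_of_eventuallyEq (fun x _ => analyticAt_const) hzero
  ext f
  refine apply_eq_zero_of_forall_hasCompactSupport u f fun g hg _ => ?_
  rw [hku g hg, hk0]
  simp

end DispersiveFBI

theorem mainTheorem5 (w : Polynomial ℝ) (hw : 2 ≤ w.natDegree) (t : ℝ) (ht : t ≠ 0) :
    -- `I` is the FBI transform of `K_t`, up to a constant factor
    (∀ (τ : ℝ) (hτ : 0 < τ) (x ξ : ℝ),
      DispersiveFBI.fbiTransform
          (DispersiveFBI.fundamentalSolution (fun η => w.eval η) t) τ hτ x (τ * ξ) =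
        (1 / (2 * Real.sqrt Real.pi) : ℝ) *
          DispersiveFBI.fbiIntegral (fun η => w.eval η) t x ξ (Real.sqrt τ)) ∧
    -- exponential decay of `I`
    (∀ x₀ : ℝ, ∃ U ∈ nhds x₀, ∃ C > (0 : ℝ), ∃ σ > (0 : ℝ), ∃ M > (0 : ℝ), ∃ l₀ > (0 : ℝ),
      ∀ ξ : ℝ, M < |ξ| → ∀ x ∈ U, ∀ l : ℝ, l₀ < l →
        ‖DispersiveFBI.fbiIntegral (fun η => w.eval η) t x ξ l‖ ≤
          C * Real.exp (-(σ * l ^ 2))) ∧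
    -- `K_t` is real-analytic
    DispersiveFBI.IsRealAnalytic
      (DispersiveFBI.fundamentalSolution (fun η => w.eval η) t) ∧
    -- `U(t)φ` has full support for every nonzero compactly supported `φ`
    (∀ φ : TemperedDistribution ℝ ℂ, IsCompact (Distribution.dsupport φ) → φ ≠ 0 →
      Distribution.dsupport (DispersiveFBI.propagator (fun η => w.eval η) t φ) = Set.univ) := by
  refine ⟨fun τ hτ x ξ => DispersiveFBI.fbiTransform_fundamentalSolution w t τ hτ x ξ,
    DispersiveFBI.exists_norm_fbiIntegral_le w hw t ht,
    DispersiveFBI.isRealAnalytic_propagator w hw t ht _ ?_, fun φ hφ hne => ?_⟩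
  · rw [Distribution.TemperedDistribution.dsupport_delta]
    exact isCompact_singleton
  · by_contra h
    exact hne (DispersiveFBI.propagator_injective w t φ
      ((DispersiveFBI.isRealAnalytic_propagator w hw t ht φ hφ).eq_zero_of_dsupport_ne_univ h))
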